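/- Let $\mathbb{D}$ be the open unit disk with the hyperbolic metric $\mathbf{g}_{\mathbb{D}}=\frac{4(dx^2+dy^2)}{(1-|z|^2)^2}$, and let $\mathrm{PSU}(1,1)=\mathrm{SU}(1,1)/\{\pm 1\}$ act on $\mathbb{D}$ by $\gamma(z)=\frac{az+b}{\bar b z+\bar a}$, $|a|^2-|b|^2=1$. Vector fields on $\mathbb{D}$ are functions $\mathbb{D}\to\mathbb{C}$, and $\gamma^*\psi=\psi(\gamma)\,\gamma'^{-1}$. Let $\mathfrak{g}$ be the real vector space of Killing vector fields on $\mathbb{D}$ (smooth $\xi$ with $\mathcal{L}_\xi\mathbf{g}_{\mathbb{D}}=0$). For a subgroup $\Gamma$, $Z^1(\Gamma;\mathfrak{g})$ is the space of maps $c:\Gamma\to\mathfrak{g}$ with $c_{\gamma_1\gamma_2}=\gamma_2^*c_{\gamma_1}+c_{\gamma_2}$; for a vector field $\psi$, $\delta\psi$ is the map $\gamma\mapsto\gamma^*\psi-\psi$; $B^1(\Gamma;\mathfrak{g})=\{\delta m: m\in\mathfrak{g}\}$; and $H^1(\Gamma;\mathfrak{g})=Z^1/B^1$. $\mathrm{HQD}(\mathbb{D},\Gamma)$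 is the space of holomorphic $f\,dz^2$ on $\mathbb{D}$ with $f(\gamma(z))\gamma'(z)^2=f(z)$ for all $\gamma\in\Gamma$. For a smooth vector field $\xi$, $(\mathcal{L}_\xi\mathbf{g}_{\mathbb{D}})^{(2,0)}=f\,dz^2$ is the quadratic differential for which $\mathrm{Re}(f\,dz^2)$ is the trace-free part of $\mathcal{L}_\xi\mathbf{g}_{\mathbb{D}}$. A smooth vector field $\xi$ is harmonic if there is a smooth family of smooth maps $\phi_t:\mathbb{D}\to\mathbb{D}$, $t\in[0,\varepsilon)$, with $\phi_0=\mathrm{id}$, $\frac{d}{dt}\big|_{t=0}\phi_t=\xi$ and $\frac{d}{dt}\big|_{t=0}\tau(\phi_t)=0$, where $\tau$ is the tension field with respect to $\mathbf{g}_{\mathbb{D}}$. A continuous vector field $\psi$ on $\mathbb{D}$ has an $L^2$-extension to $\overline{\mathbb{D}}$, with restriction $\psi^\sharp\in L^2(\mathbb{S}^1,\mathbb{C})$ to $\mathbb{S}^1$, if $w\mapsto\psi(rw)$ converges to $\psi^\sharp$ in $L^2(\mathbb{S}^1,\mathbb{C})$ as $r\to1^-$. An $L^2$ vector field $X$ on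 $\mathbb{S}^1$ is tangential if $X(w)=f(w)\,\iota w$ almost everywhere with $f$ real-valued; for such $X$ the Poisson map is $$\mathcal{F}(X)(z)=\frac{1}{2\pi}\int_{\mathbb{S}^1} f(w)\,w\,\mathbf{K}(w^{-1}z)\,|dw|,\qquad \mathbf{K}(z)=\frac{\iota(1-|z|^2)^3}{|1-\bar z|^2(1-\bar z)^2},$$ i.e. the normalized convolution of $f$ with the vector field $\mathbf{K}$, which is carried to $z\mapsto w\,\mathbf{K}(w^{-1}z)$ by the rotation by $w$. Theorem. Let $\Gamma$ be a discrete subgroup of $\mathrm{PSU}(1,1)$ with $\mathbb{D}/\Gamma$ compact. (1) For every $c\in Z^1(\Gamma;\mathfrak{g})$ there is a smooth vector field $\psi$ on $\mathbb{D}$ with $c=\delta\psi$. (2) Every smooth vector field $\psi$ on $\mathbb{D}$ with $\delta\psi=c$ for some $c\in Z^1(\Gamma;\mathfrak{g})$ admits an $L^2$-extension to $\overline{\mathbb{D}}$; its restriction $\psi^\sharp$ to $\mathbb{S}^1$ is unique and tangential. (3) There is a homomorphism of real vector spaces $$\varPsi: H^1(\Gamma;\mathfrak{g})\longrightarrow\mathrm{HQD}(\mathbb{D},\Gamma),\qquad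 [c]\longmapsto\big(\mathcal{L}_{\mathcal{F}(\psi^\sharp)}\mathbf{g}_{\mathbb{D}}\big)^{(2,0)},$$ where, for every $c\in Z^1(\Gamma;\mathfrak{g})$ representing the class and every smooth $\psi$ with $\delta\psi=c$, the formula holds and $\mathcal{F}(\psi^\sharp)$ is a harmonic vector field on $\mathbb{D}$. -/

import Mathlib

open scoped Complex.UnitDisc ComplexConjugate Topology ContDiff

set_option maxSynthPendingDepth 3

noncomputable section

namespace DiskVF

open Complex MeasureTheory Filter Set

/-! ### The group `PSU(1,1)` and its action on the unit disk -/

/-- `SU(1,1)`: the matrices `[[a, b], [conj b, conj a]]` with `|a|² - |b|² = 1`. -/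
def SU11 : Subgroup (Matrix.SpecialLinearGroup (Fin 2) ℂ) where
  carrier := {A | A 1 0 = conj (A 0 1) ∧ A 1 1 = conj (A 0 0)}
  one_mem' := by simp
  mul_mem' := by
    rintro A B ⟨hA, hA'⟩ ⟨hB, hB'⟩
    simp only [mem_ofPred_eq, Matrix.SpecialLinearGroup.coe_mul, Matrix.mul_apply,
      Fin.sum_univ_two, hA, hA', hB, hB', map_add, map_mul, Complex.conj_conj]
    constructor <;> ring
  inv_mem' := by
    rintro A ⟨hA, hA'⟩
    simp only [mem_ofPred_eq, Matrix.SpecialLinearGroup.coe_inv, Matrix.adjugate_fin_two,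
      Matrix.of_apply, Matrix.cons_val', Matrix.cons_val_zero, Matrix.cons_val_one,
      Matrix.cons_val_fin_one, hA, hA', map_neg, Complex.conj_conj]
    simp

lemma SU11_normSq (A : SU11) :
    normSq (A.1 0 0) - normSq (A.1 0 1) = 1 := by
  obtain ⟨A, hA, hA'⟩ := A
  have h := A.det_coe
  rw [Matrix.det_fin_two, hA, hA', Complex.mul_conj, Complex.mul_conj] at h
  exact_mod_cast h

lemma SU11_normSq_den (A : SU11) (z : ℂ) :
    normSq (A.1 1 0 * z + A.1 1 1) - normSq (A.1 0 0 * z + A.1 0 1) = 1 - normSq z := by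
  have h := SU11_normSq A
  obtain ⟨A, hA, hA'⟩ := A
  simp only [hA, hA'] at h ⊢
  simp only [normSq_apply, add_re, add_im, mul_re, mul_im, conj_re, conj_im] at h ⊢
  linear_combination (1 - (z.re * z.re + z.im * z.im)) * h

lemma SU11_den_ne_zero (A : SU11) (z : 𝔻) : A.1 1 0 * (z : ℂ) + A.1 1 1 ≠ 0 := by
  intro h0
  have h := SU11_normSq_den A z
  rw [h0, map_zero] at h
  have := z.normSq_lt_one
  have := normSq_nonneg (A.1 0 0 * (z : ℂ) + A.1 0 1)
  linarith

lemma SU11_norm_lt_one (A : SU11) (z : 𝔻) :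
    ‖(A.1 0 0 * (z : ℂ) + A.1 0 1) / (A.1 1 0 * (z : ℂ) + A.1 1 1)‖ < 1 := by
  have h := SU11_normSq_den A z
  have hz := z.normSq_lt_one
  rw [norm_div, div_lt_one (norm_pos_iff.2 (SU11_den_ne_zero A z)),
    ← sq_lt_sq₀ (norm_nonneg _) (norm_nonneg _), ← normSq_eq_norm_sq, ← normSq_eq_norm_sq]
  linarith

/-- `SU(1,1)` acts on the disk by `z ↦ (a z + b) / (conj b z + conj a)`. -/
instance : MulAction SU11 𝔻 where
  smul A z := UnitDisc.mk _ (SU11_norm_lt_one A z)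
  one_smul z := by
    apply UnitDisc.coe_injective
    change ((1 : Matrix (Fin 2) (Fin 2) ℂ) 0 0 * (z : ℂ) + (1 : Matrix (Fin 2) (Fin 2) ℂ) 0 1) /
      ((1 : Matrix (Fin 2) (Fin 2) ℂ) 1 0 * (z : ℂ) + (1 : Matrix (Fin 2) (Fin 2) ℂ) 1 1) = z
    simp
  mul_smul A B z := by
    apply UnitDisc.coe_injective
    change ((A.1.1 * B.1.1) 0 0 * (z : ℂ) + (A.1.1 * B.1.1) 0 1) /
      ((A.1.1 * B.1.1) 1 0 * (z : ℂ) + (A.1.1 * B.1.1) 1 1) =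
      (A.1 0 0 * ((B.1 0 0 * (z : ℂ) + B.1 0 1) / (B.1 1 0 * (z : ℂ) + B.1 1 1)) + A.1 0 1) /
      (A.1 1 0 * ((B.1 0 0 * (z : ℂ) + B.1 0 1) / (B.1 1 0 * (z : ℂ) + B.1 1 1)) + A.1 1 1)
    have hB := SU11_den_ne_zero B z
    simp only [Matrix.mul_apply, Fin.sum_univ_two]
    rw [mul_div_assoc', div_add' _ _ _ hB, mul_div_assoc', div_add' _ _ _ hB,
      div_div_div_cancel_right₀ hB]
    congr 1 <;> ring

lemma SU11_coe_smul (A : SU11) (z : 𝔻) :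
    ((A • z : 𝔻) : ℂ) = (A.1 0 0 * (z : ℂ) + A.1 0 1) / (A.1 1 0 * (z : ℂ) + A.1 1 1) := rfl

/-- The subgroup `{±1}` of `SU(1,1)`. -/
def plusMinusOne : Subgroup SU11 where
  carrier := {A | A.1 = 1 ∨ A.1 = -1}
  one_mem' := Or.inl rfl
  mul_mem' := by
    rintro A B (hA | hA) (hB | hB)
    · left; rw [Subgroup.coe_mul, hA, hB, mul_one]
    · right; rw [Subgroup.coe_mul, hA, hB, one_mul]
    · right; rw [Subgroup.coe_mul, hA, hB, mul_one]
    · left; rw [Subgroup.coe_mul, hA, hB, neg_mul_neg, mul_one]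
  inv_mem' := by
    rintro A (hA | hA)
    · left; rw [Subgroup.coe_inv, hA, inv_one]
    · right
      rw [Subgroup.coe_inv, hA, inv_eq_iff_mul_eq_one]
      simp

instance : plusMinusOne.Normal where
  conj_mem := by
    rintro A (hA | hA) B
    · left; simp [hA]
    · right; simp [hA]

/-- `PSU(1,1) = SU(1,1) / {±1}`, with the quotient topology. -/
abbrev PSU11 : Type := SU11 ⧸ plusMinusOne

/-- The action of `PSU(1,1)` on the disk as a homomorphism to permutations. -/
def PSU11.toPerm : PSU11 →* Equiv.Perm 𝔻 :=
  QuotientGroup.lift plusMinusOne (MulAction.toPermHom SU11 𝔻) (by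
    rintro A (hA | hA) <;> ext z <;>
      simp [SU11_coe_smul, hA])

instance : MulAction PSU11 𝔻 := MulAction.compHom 𝔻 PSU11.toPerm

lemma PSU11.mk_smul (A : SU11) (z : 𝔻) : (QuotientGroup.mk A : PSU11) • z = A • z := rfl

/-! ### Vector fields on the disk

A vector field on the disk is a function `𝔻 → ℂ`, the tangent spaces being identified with `ℂ`. -/

/-- Extension by zero of a function on the disk to `ℂ`; only its values on the open disk matter,
and they serve to differentiate. -/
def extend (ψ : 𝔻 → ℂ) (z : ℂ) : ℂ := if h : ‖z‖ < 1 then ψ (UnitDisc.mk z h) else 0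

lemma extend_add (ψ φ : 𝔻 → ℂ) : extend (ψ + φ) = extend ψ + extend φ := by
  funext z; by_cases h : ‖z‖ < 1 <;> simp [extend, h]

lemma extend_const_smul {R : Type*} [SMulZeroClass R ℂ] (r : R) (ψ : 𝔻 → ℂ) :
    extend (r • ψ) = r • extend ψ := by
  funext z; by_cases h : ‖z‖ < 1 <;> simp [extend, h]

lemma extend_zero : extend 0 = 0 := by
  funext z; by_cases h : ‖z‖ < 1 <;> simp [extend, h]

/-- Smooth (`C^∞` in the real sense) vector fields on the open disk. -/
def IsSmooth (ψ : 𝔻 → ℂ) : Prop := ContDiffOn ℝ ∞ (extend ψ) (Metric.ball 0 1)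

lemma IsSmooth.differentiableAt {ψ : 𝔻 → ℂ} (h : IsSmooth ψ) (z : 𝔻) :
    DifferentiableAt ℝ (extend ψ) z :=
  (h.contDiffAt (Metric.isOpen_ball.mem_nhds (mem_ball_zero_iff.2 z.norm_lt_one))).differentiableAt
    (by simp)

/-- The complex derivative `γ'(z)` of the Möbius transformation `γ` at `z`. -/
def mobDeriv (γ : PSU11) (z : 𝔻) : ℂ := deriv (extend fun w => ((γ • w : 𝔻) : ℂ)) z

/-- The (right) action `γ^* ψ = ψ(γ) (γ')⁻¹` on vector fields. -/
def pullback (γ : PSU11) (ψ : 𝔻 → ℂ) (z : 𝔻) : ℂ := ψ (γ • z) * (mobDeriv γ z)⁻¹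

/-! ### The hyperbolic metric, Lie derivatives, Killing fields -/

/-- The hyperbolic metric `4 (dx² + dy²) / (1 - |z|²)²` at `z`, applied to `u` and `v`. -/
def metric (z u v : ℂ) : ℝ := 4 / (1 - normSq z) ^ 2 * (u * conj v).re

/-- The Lie derivative `L_ξ g` of the hyperbolic metric at `z`, applied to `u` and `v`:
`D_ξ (g(u, v)) + g(Dξ u, v) + g(u, Dξ v)` for constant `u` and `v`. -/
def lieMetric (ξ : 𝔻 → ℂ) (z : 𝔻) (u v : ℂ) : ℝ :=
  fderiv ℝ (fun w : ℂ => metric w u v) z (ξ z) + metric z (fderiv ℝ (extend ξ) z u) v +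
    metric z u (fderiv ℝ (extend ξ) z v)

/-- The coefficient `f` of `(L_ξ g)^{(2,0)} = f dz²`, that is, the function `f` for which
`Re (f dz²)` is the trace-free part `TF` of `L_ξ g`; so `f = TF(1, 1) - i TF(1, i)`. -/
def quadDiff (ξ : 𝔻 → ℂ) (z : 𝔻) : ℂ :=
  (((lieMetric ξ z 1 1 - lieMetric ξ z I I) / 2 : ℝ) : ℂ) - I * (lieMetric ξ z 1 I : ℝ)

lemma metric_add_left (z u u' v : ℂ) : metric z (u + u') v = metric z u v + metric z u' v := by
  simp only [metric, add_mul, add_re]; ring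

lemma metric_add_right (z u v v' : ℂ) : metric z u (v + v') = metric z u v + metric z u v' := by
  simp only [metric, map_add, mul_add, add_re]

lemma metric_smul_left (r : ℝ) (z u v : ℂ) : metric z (r • u) v = r * metric z u v := by
  simp only [metric, real_smul, mul_assoc, re_ofReal_mul]; ring

lemma metric_smul_right (r : ℝ) (z u v : ℂ) : metric z u (r • v) = r * metric z u v := by
  simp only [metric, real_smul, map_mul, conj_ofReal, mul_left_comm u, re_ofReal_mul]; ring

lemma lieMetric_add {ξ η : 𝔻 → ℂ} (hξ : IsSmooth ξ) (hη : IsSmooth η) (z : 𝔻) (u v : ℂ) :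
    lieMetric (ξ + η) z u v = lieMetric ξ z u v + lieMetric η z u v := by
  simp only [lieMetric, extend_add, fderiv_add (hξ.differentiableAt z) (hη.differentiableAt z),
    Pi.add_apply, map_add, _root_.add_apply, metric_add_left, metric_add_right]
  ring

lemma lieMetric_smul {ξ : 𝔻 → ℂ} (hξ : IsSmooth ξ) (r : ℝ) (z : 𝔻) (u v : ℂ) :
    lieMetric (r • ξ) z u v = r * lieMetric ξ z u v := by
  simp only [lieMetric, extend_const_smul, fderiv_const_smul (hξ.differentiableAt z),
    Pi.smul_apply, map_smul, _root_.smul_apply, metric_smul_left, metric_smul_right,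
    smul_eq_mul]
  ring

lemma lieMetric_zero (z : 𝔻) (u v : ℂ) : lieMetric 0 z u v = 0 := by
  simp [lieMetric, extend_zero, metric]

/-- The Lie algebra `g` of `PSU(1,1)`: the real vector space of Killing vector fields on the disk,
i.e. of the smooth vector fields `ξ` with `L_ξ g = 0`. -/
def killing : Submodule ℝ (𝔻 → ℂ) where
  carrier := {ξ | IsSmooth ξ ∧ ∀ z u v, lieMetric ξ z u v = 0}
  zero_mem' := ⟨by rw [IsSmooth, extend_zero]; exact contDiffOn_const, lieMetric_zero⟩
  add_mem' := by
    rintro ξ η ⟨hξ, hξ'⟩ ⟨hη, hη'⟩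
    refine ⟨by rw [IsSmooth, extend_add]; exact ContDiffOn.add hξ hη, fun z u v => ?_⟩
    rw [lieMetric_add hξ hη, hξ', hη', add_zero]
  smul_mem' := by
    rintro r ξ ⟨hξ, hξ'⟩
    refine ⟨by rw [IsSmooth, extend_const_smul]; exact ContDiffOn.const_smul r hξ,
      fun z u v => ?_⟩
    rw [lieMetric_smul hξ, hξ', mul_zero]

/-! ### Harmonic vector fields -/

/-- The Christoffel symbols of the Levi-Civita connection of the hyperbolic metric, as the bilinear
map `Γ(u, v)^k = ½ ∑_l g^{kl} (D_u g(v, e_l) + D_v g(u, e_l) - D_{e_l} g(u, v))`, where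
`e_1 = 1`, `e_2 = i` (so that `g^{kl}` is diagonal, with entries `1 / g(1, 1)`). -/
def christoffel (z u v : ℂ) : ℂ :=
  let k : ℂ → ℝ := fun e =>
    1 / (2 * metric z 1 1) * (fderiv ℝ (fun w : ℂ => metric w v e) z u +
      fderiv ℝ (fun w : ℂ => metric w u e) z v - fderiv ℝ (fun w : ℂ => metric w u v) z e)
  k 1 + k I * I

/-- The tension field (Eells-Sampson Laplacian) at `z` of a map `φ` of the disk with the hyperbolic
metric to itself:
`∑_{i,j} g^{ij} (∂_i ∂_j φ - ∑_k Γ^k_{ij} ∂_k φ + Γ_{φ(z)}(∂_i φ, ∂_j φ))`. -/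
def tension (φ : ℂ → ℂ) (z : ℂ) : ℂ :=
  let s : ℂ → ℂ := fun e =>
    fderiv ℝ (fun w => fderiv ℝ φ w e) z e - fderiv ℝ φ z (christoffel z e e) +
      christoffel (φ z) (fderiv ℝ φ z e) (fderiv ℝ φ z e)
  (1 / metric z 1 1 : ℝ) * (s 1 + s I)

/-- A smooth vector field `ξ` on the disk is harmonic if there is a smooth family of smooth maps
`φ_t : 𝔻 → 𝔻`, `t ∈ [0, ε)`, with `φ_0` the identity, `dφ_t/dt = ξ` at `t = 0`, and
`d/dt τ(φ_t)(z) = 0` at `t = 0` for all `z`, where `τ` is the tension field. -/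
def IsHarmonic (ξ : 𝔻 → ℂ) : Prop :=
  IsSmooth ξ ∧ ∃ ε > (0 : ℝ), ∃ φ : ℝ → ℂ → ℂ,
    ContDiffOn ℝ ∞ (fun p : ℝ × ℂ => φ p.1 p.2) (Ico 0 ε ×ˢ Metric.ball 0 1) ∧
    (∀ t ∈ Ico 0 ε, MapsTo (φ t) (Metric.ball 0 1) (Metric.ball 0 1)) ∧
    (∀ z : 𝔻, φ 0 z = z) ∧
    (∀ z : 𝔻, HasDerivWithinAt (fun t => φ t z) (ξ z) (Ici 0) 0) ∧
    (∀ z : 𝔻, HasDerivWithinAt (fun t => tension (φ t) z) 0 (Ici 0) 0)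

/-! ### Group cohomology and quadratic differentials -/

/-- The coboundary `δψ : γ ↦ γ^* ψ - ψ` of a vector field `ψ`. -/
def coboundary (Γ : Subgroup PSU11) (ψ : 𝔻 → ℂ) (γ : Γ) : 𝔻 → ℂ :=
  fun z => pullback γ ψ z - ψ z

/-- `Z¹(Γ; g)`: the maps `c : Γ → g` with `c_{γ₁ γ₂} = γ₂^* c_{γ₁} + c_{γ₂}`. -/
def Z1 (Γ : Subgroup PSU11) : Submodule ℝ (Γ → killing) where
  carrier := {c | ∀ γ₁ γ₂ : Γ, ∀ z : 𝔻,
    (c (γ₁ * γ₂) : 𝔻 → ℂ) z = pullback γ₂ (c γ₁) z + (c γ₂ : 𝔻 → ℂ) z}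
  zero_mem' := by intro γ₁ γ₂ z; simp [pullback]
  add_mem' := by
    intro c d hc hd γ₁ γ₂ z
    have h1 := hc γ₁ γ₂ z
    have h2 := hd γ₁ γ₂ z
    simp only [pullback, Pi.add_apply, Submodule.coe_add] at h1 h2 ⊢
    rw [h1, h2]; ring
  smul_mem' := by
    intro r c hc γ₁ γ₂ z
    have h1 := hc γ₁ γ₂ z
    simp only [pullback, Pi.smul_apply, Submodule.coe_smul, real_smul] at h1 ⊢
    rw [h1]; ring

/-- `B¹(Γ; g)`: the cocycles of the form `δm` with `m ∈ g`. -/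
def B1 (Γ : Subgroup PSU11) : Submodule ℝ (Z1 Γ) where
  carrier := {c | ∃ m : killing, ∀ γ : Γ, (c.1 γ : 𝔻 → ℂ) = coboundary Γ m γ}
  zero_mem' := ⟨0, fun γ => by funext z; simp [coboundary, pullback]⟩
  add_mem' := by
    rintro c d ⟨m, hm⟩ ⟨n, hn⟩
    refine ⟨m + n, fun γ => ?_⟩
    funext z
    have h1 := congrFun (hm γ) z
    have h2 := congrFun (hn γ) z
    simp only [coboundary, pullback, Pi.add_apply, Submodule.coe_add] at h1 h2 ⊢
    rw [h1, h2]; ring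
  smul_mem' := by
    rintro r c ⟨m, hm⟩
    refine ⟨r • m, fun γ => ?_⟩
    funext z
    have h1 := congrFun (hm γ) z
    simp only [coboundary, pullback, Pi.smul_apply, Submodule.coe_smul, real_smul] at h1 ⊢
    rw [h1]; ring

/-- `H¹(Γ; g) = Z¹(Γ; g) / B¹(Γ; g)`. -/
abbrev H1 (Γ : Subgroup PSU11) : Type := Z1 Γ ⧸ B1 Γ

/-- `HQD(𝔻, Γ)`: the holomorphic quadratic differentials `f dz²` on the disk that are
`Γ`-invariant, i.e. `f(γ(z)) γ'(z)² = f(z)`. -/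
def HQD (Γ : Subgroup PSU11) : Submodule ℂ (𝔻 → ℂ) where
  carrier := {f | DifferentiableOn ℂ (extend f) (Metric.ball 0 1) ∧
    ∀ γ : Γ, ∀ z : 𝔻, f (γ • z) * mobDeriv γ z ^ 2 = f z}
  zero_mem' := ⟨by rw [extend_zero]; exact differentiableOn_const 0, by simp⟩
  add_mem' := by
    rintro f h ⟨hf, hf'⟩ ⟨hh, hh'⟩
    refine ⟨by simpa [extend_add] using hf.add hh, fun γ z => ?_⟩
    simp only [Pi.add_apply, add_mul, hf', hh']
  smul_mem' := by
    rintro r f ⟨hf, hf'⟩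
    refine ⟨by simpa [extend_const_smul] using hf.const_smul r, fun γ z => ?_⟩
    simp only [Pi.smul_apply, smul_eq_mul, mul_assoc, hf']

/-! ### Vector fields on the circle and the Poisson map -/

instance : Fact (0 < 2 * Real.pi) := ⟨Real.two_pi_pos⟩

/-- The normalised arc length `dθ / 2π` on the unit circle, whose points `w = e^{iθ}` are
parametrised by the angle `θ ∈ ℝ / 2πℤ`. -/
def arc : Measure (AddCircle (2 * Real.pi)) := AddCircle.haarAddCircle

/-- The Hilbert space of `L²` vector fields (with values in `ℂ`) on the unit circle. -/
abbrev CircleL2 : Type := Lp ℂ 2 arc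

/-- The point `e^{iθ}` of the unit circle. -/
def pt (θ : AddCircle (2 * Real.pi)) : ℂ := (AddCircle.toCircle θ : ℂ)

/-- `X` is tangential: `X(w) = f(w) i w` with `f` real-valued. -/
def IsTangential (X : CircleL2) : Prop :=
  ∀ᵐ θ ∂arc, ∃ t : ℝ, X θ = t * (I * pt θ)

/-- `X` is the restriction to the circle of an `L²`-extension of `ψ` to the closed disk: the
restrictions of `ψ` to the circles of radius `r < 1`, viewed as vector fields on the unit circle,
converge to `X` in `L²` as `r → 1`. -/
def IsL2Boundary (ψ : 𝔻 → ℂ) (X : CircleL2) : Prop :=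
  Tendsto (fun r : ℝ => eLpNorm (fun θ => extend ψ (r * pt θ) - X θ) 2 arc) (𝓝[<] 1) (𝓝 0)

/-- The Poisson kernel vector field `K(z) = i (1 - |z|²)³ / (|1 - conj z|² (1 - conj z)²)`. -/
def poissonKernel (z : ℂ) : ℂ :=
  I * (1 - ‖z‖ ^ 2 : ℝ) ^ 3 / ((‖1 - conj z‖ ^ 2 : ℝ) * (1 - conj z) ^ 2)

/-- The Poisson map for vector fields: for `X = f Y` with `Y(w) = i w`, it is the normalised
convolution `f * K`, i.e. the average over `w` in the circle of `f(w)` times the push-forward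
`z ↦ w K(w⁻¹ z)` of the vector field `K` under the rotation by `w`. -/
def poissonMap (X : CircleL2) (z : 𝔻) : ℂ :=
  ∫ θ, X θ / (I * pt θ) * (pt θ * poissonKernel ((pt θ)⁻¹ * z)) ∂arc

end DiskVF

end

noncomputable section

namespace DiskVF

open Complex MeasureTheory Filter Set

/-! ### The extension by zero -/

/-! Potentials exist by averaging. With a bump function b whose translates are locally finite and
cover the disk, ψ(z) = -∑ b(γz) c_γ(z) / ∑ b(γz) satisfies δψ = c by the cocycle relation
(`exists_potential`). Discreteness gives local finiteness (`finite_smul_meets`), cocompactness a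
nonzero denominator (`exists_radius`).

Boundary values come from comparison with Killing fields, which are quadratic polynomials
(`killing_eq`). If η moves a point at distance s from the circle into a fixed compact set, then ψ +
c_η = η^*ψ has size O(s) there, because |η'|⁻¹ is comparable to s (`exists_near_cocycle`). So on
each dyadic piece of a radius ψ is a quadratic polynomial in s up to O(s). Third-order
multiplicative differences kill quadratics, and undoing them scale by scale gives a limit at rate
√s, uniformly over the circle (`exists_limit_of_near_quadratic`). The radial component of a Killing
field vanishes on the circle, which makes the limit tangential (`exists_hasBdry`). Two potentials of
one cocycle differ by an invariant field, which is O(s), so the boundary field Y depends on c only.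

The Poisson kernel splits into a holomorphic term and powers of 1 - |z|² times antiholomorphic terms
(`kernel_eq`). The ∂̄-derivative telescopes to 3(1 - |z|²)² times the conjugate of a holomorphic
function V₄ (`hasW_poissonFun`). This form satisfies the linearised harmonic map equation and makes
the (2,0)-part equal to 24 V₄. For tangential Y, V₄(z) is minus the contour integral (1/2πi)∮ Y(w)(w
- z)⁻⁴ dw. Quadratic polynomials integrate to zero, so coboundaries are killed. Under γ ∈ Γ the
field Y changes by the vector field rule up to a quadratic polynomial, so a change of variables
gives V₄ weight four (`conjCauchy_mob`). -/

lemma extend_coe (ψ : 𝔻 → ℂ) (z : 𝔻) : extend ψ z = ψ z := by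
  simp [extend, z.norm_lt_one]

lemma extend_mk (ψ : 𝔻 → ℂ) {z : ℂ} (h : ‖z‖ < 1) : extend ψ z = ψ (UnitDisc.mk z h) := by
  simp [extend, h]

lemma mem_ball_coe (z : 𝔻) : (z : ℂ) ∈ Metric.ball (0 : ℂ) 1 := mem_ball_zero_iff.2 z.norm_lt_one

lemma ball_mem_nhds (z : 𝔻) : Metric.ball (0 : ℂ) 1 ∈ 𝓝 (z : ℂ) :=
  Metric.isOpen_ball.mem_nhds (mem_ball_coe z)

lemma eqOn_extend {ψ : 𝔻 → ℂ} {F : ℂ → ℂ} (h : ∀ z : 𝔻, ψ z = F z) :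
    EqOn (extend ψ) F (Metric.ball 0 1) := by
  intro z hz
  rw [extend_mk _ (mem_ball_zero_iff.1 hz), h, UnitDisc.coe_mk]

lemma eventuallyEq_extend {ψ : 𝔻 → ℂ} {F : ℂ → ℂ} (h : ∀ z : 𝔻, ψ z = F z) (z : 𝔻) :
    extend ψ =ᶠ[𝓝 (z : ℂ)] F :=
  (eqOn_extend h).eventuallyEq_of_mem (ball_mem_nhds z)

lemma exists_bound_of_normSq_le {ψ : 𝔻 → ℂ} (h : IsSmooth ψ) {κ : ℝ} (hκ : 0 < κ) :
    ∃ M, 0 ≤ M ∧ ∀ z : 𝔻, κ ≤ 1 - normSq z → ‖ψ z‖ ≤ M := by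
  have hc : IsCompact (Metric.closedBall (0 : ℂ) 1 ∩ {z | κ ≤ 1 - normSq z}) :=
    (isCompact_closedBall 0 1).inter_right
      (isClosed_le continuous_const (continuous_const.sub continuous_normSq))
  have hs : Metric.closedBall (0 : ℂ) 1 ∩ {z | κ ≤ 1 - normSq z} ⊆ Metric.ball 0 1 := by
    rintro z ⟨-, hz⟩
    have hz : κ ≤ 1 - normSq z := hz
    rw [normSq_eq_norm_sq] at hz
    rw [mem_ball_zero_iff]
    nlinarith [norm_nonneg z]
  obtain ⟨M, hM⟩ := hc.exists_bound_of_continuousOn (h.continuousOn.mono hs)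
  refine ⟨max M 0, le_max_right _ _, fun z hz => ?_⟩
  rw [← extend_coe ψ z]
  exact (hM z ⟨mem_closedBall_zero_iff.2 z.norm_lt_one.le, hz⟩).trans (le_max_left _ _)

/-! ### Möbius transformations -/

/-- The denominator `c z + d` of the Möbius transformation with matrix `A`. -/
def den (A : SU11) (z : ℂ) : ℂ := A.1 1 0 * z + A.1 1 1

/-- The Möbius transformation with matrix `A`, as a map on `ℂ`. -/
def mob (A : SU11) (z : ℂ) : ℂ := (A.1 0 0 * z + A.1 0 1) / den A z

lemma SU11_c (A : SU11) : A.1 1 0 = conj (A.1 0 1) := A.2.1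

lemma SU11_d (A : SU11) : A.1 1 1 = conj (A.1 0 0) := A.2.2

lemma SU11_det (A : SU11) : A.1 0 0 * conj (A.1 0 0) - A.1 0 1 * conj (A.1 0 1) = 1 := by
  have h := A.1.det_coe
  rwa [Matrix.det_fin_two, SU11_c, SU11_d] at h

lemma coe_smul_eq_mob (A : SU11) (z : 𝔻) : (((QuotientGroup.mk A : PSU11) • z : 𝔻) : ℂ) = mob A z :=
  rfl

lemma norm_b_lt_norm_a (A : SU11) : ‖A.1 0 1‖ < ‖A.1 0 0‖ := by
  have h := SU11_normSq A
  rw [normSq_eq_norm_sq, normSq_eq_norm_sq] at h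
  nlinarith [norm_nonneg (A.1 0 1), norm_nonneg (A.1 0 0)]

lemma den_ne_zero (A : SU11) {z : ℂ} (hz : ‖z‖ ≤ 1) : den A z ≠ 0 := by
  intro h
  have h1 : A.1 1 0 * z = - A.1 1 1 := eq_neg_of_add_eq_zero_left h
  have h2 := congrArg norm h1
  rw [norm_mul, norm_neg, SU11_c, SU11_d, norm_conj, norm_conj] at h2
  nlinarith [norm_b_lt_norm_a A, norm_nonneg (A.1 0 1), norm_nonneg z]

/-- Polarised invariance of the Hermitian form preserved by SU(1,1). The diagonal case gives the
isometry property, the general one controls hyperbolic distances. -/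
lemma one_sub_conj_mob_mul_mob (A : SU11) {z w : ℂ} (hz : ‖z‖ ≤ 1) (hw : ‖w‖ ≤ 1) :
    1 - conj (mob A z) * mob A w = (1 - conj z * w) / (conj (den A z) * den A w) := by
  have h1 := den_ne_zero A hz
  have h2 := den_ne_zero A hw
  have h3 : conj (den A z) ≠ 0 := (map_ne_zero _).2 h1
  have h := SU11_det A
  rw [mob, mob, map_div₀, eq_div_iff (mul_ne_zero h3 h2)]
  field_simp
  simp only [den, SU11_c, SU11_d, map_add, map_mul, conj_conj]
  linear_combination (1 - conj z * w) * h

lemma mob_sub_mob (A : SU11) {z w : ℂ} (hz : ‖z‖ ≤ 1) (hw : ‖w‖ ≤ 1) :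
    mob A z - mob A w = (z - w) / (den A z * den A w) := by
  have h1 := den_ne_zero A hz
  have h2 := den_ne_zero A hw
  have h := SU11_det A
  rw [mob, mob, eq_div_iff (mul_ne_zero h1 h2)]
  field_simp
  simp only [den, SU11_c, SU11_d]
  linear_combination (z - w) * h

lemma one_sub_normSq_mob (A : SU11) {z : ℂ} (hz : ‖z‖ ≤ 1) :
    1 - normSq (mob A z) = (1 - normSq z) / normSq (den A z) := by
  have h := one_sub_conj_mob_mul_mob A hz hz
  rw [← normSq_eq_conj_mul_self, ← normSq_eq_conj_mul_self, ← normSq_eq_conj_mul_self] at h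
  exact_mod_cast h

lemma hasDerivAt_mob (A : SU11) {z : ℂ} (hz : ‖z‖ ≤ 1) :
    HasDerivAt (mob A) ((den A z ^ 2)⁻¹) z := by
  have h1 := den_ne_zero A hz
  have hn : HasDerivAt (fun z : ℂ => A.1 0 0 * z + A.1 0 1) (A.1 0 0) z := by
    simpa using ((hasDerivAt_id z).const_mul (A.1 0 0)).add_const (A.1 0 1)
  have hd : HasDerivAt (den A) (A.1 1 0) z := by
    change HasDerivAt (fun z : ℂ => A.1 1 0 * z + A.1 1 1) (A.1 1 0) z
    simpa using ((hasDerivAt_id z).const_mul (A.1 1 0)).add_const (A.1 1 1)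
  refine (hn.div hd h1).congr_deriv ?_
  rw [inv_eq_one_div]
  congr 1
  simp only [den, SU11_c, SU11_d]
  linear_combination SU11_det A

lemma mobDeriv_mk (A : SU11) (z : 𝔻) : mobDeriv (QuotientGroup.mk A) z = (den A z ^ 2)⁻¹ := by
  have h : extend (fun w => (((QuotientGroup.mk A : PSU11) • w : 𝔻) : ℂ)) =ᶠ[𝓝 (z : ℂ)] mob A :=
    eventuallyEq_extend (fun w => coe_smul_eq_mob A w) z
  rw [mobDeriv, h.deriv_eq, (hasDerivAt_mob A z.norm_lt_one.le).deriv]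

lemma mobDeriv_ne_zero (γ : PSU11) (z : 𝔻) : mobDeriv γ z ≠ 0 := by
  induction γ using QuotientGroup.induction_on with
  | H A => rw [mobDeriv_mk]; exact inv_ne_zero (pow_ne_zero _ (den_ne_zero A z.norm_lt_one.le))

lemma one_sub_normSq_pos (z : 𝔻) : 0 < 1 - normSq (z : ℂ) := sub_pos.2 z.normSq_lt_one

lemma one_sub_normSq_smul (γ : PSU11) (z : 𝔻) :
    1 - normSq ((γ • z : 𝔻) : ℂ) = ‖mobDeriv γ z‖ * (1 - normSq (z : ℂ)) := by
  induction γ using QuotientGroup.induction_on with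
  | H A =>
    rw [coe_smul_eq_mob, one_sub_normSq_mob A z.norm_lt_one.le, mobDeriv_mk, norm_inv, norm_pow,
      normSq_eq_norm_sq (den A z)]
    ring

lemma norm_inv_mobDeriv (γ : PSU11) (z : 𝔻) :
    ‖(mobDeriv γ z)⁻¹‖ = (1 - normSq (z : ℂ)) / (1 - normSq ((γ • z : 𝔻) : ℂ)) := by
  have h1 := one_sub_normSq_pos z
  have h2 := norm_pos_iff.2 (mobDeriv_ne_zero γ z)
  rw [one_sub_normSq_smul, norm_inv]
  field_simp

/-- Points within bounded distance have images within bounded distance. -/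
lemma le_one_sub_normSq_smul (γ : PSU11) (z u : 𝔻) {r J : ℝ} (hr : ‖((γ • z : 𝔻) : ℂ)‖ ≤ r)
    (hr1 : r < 1) (hJ : normSq (1 - conj (z : ℂ) * u) ≤ J * ((1 - normSq (z : ℂ)) * (1 - normSq (u : ℂ)))) :
    (1 - r) ^ 2 ≤ J * (1 - normSq ((γ • u : 𝔻) : ℂ)) := by
  induction γ using QuotientGroup.induction_on with
  | H A =>
    have hz := z.norm_lt_one.le
    have hu := u.norm_lt_one.le
    have e := one_sub_conj_mob_mul_mob A hz hu
    have e1 := one_sub_normSq_mob A hz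
    have e2 := one_sub_normSq_mob A hu
    rw [coe_smul_eq_mob] at hr ⊢
    have d1 := normSq_pos.2 (den_ne_zero A hz)
    have d2 := normSq_pos.2 (den_ne_zero A hu)
    have hmu : ‖mob A u‖ ≤ 1 := by
      rw [← coe_smul_eq_mob]; exact (UnitDisc.norm_lt_one _).le
    -- The quotient |1 - z̄u|² / ((1 - |z|²)(1 - |u|²)) is Möbius invariant, so the bound by J
    -- passes to the images.
    have h1 : normSq (1 - conj (mob A z) * mob A u) ≤
        J * ((1 - normSq (mob A z)) * (1 - normSq (mob A u))) := by
      rw [e, e1, e2, normSq_div, normSq_mul, normSq_conj, div_mul_div_comm, ← mul_div_assoc]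
      gcongr
    have h2 : 1 - r ≤ ‖1 - conj (mob A z) * mob A u‖ := by
      have := norm_sub_norm_le 1 (conj (mob A z) * mob A u)
      rw [norm_one, norm_mul, norm_conj] at this
      nlinarith [norm_nonneg (mob A z), norm_nonneg (mob A u)]
    have h3 : (1 - r) ^ 2 ≤ normSq (1 - conj (mob A z) * mob A u) := by
      rw [normSq_eq_norm_sq]
      have : 0 ≤ 1 - r := by linarith
      gcongr
    have h4 : 0 < 1 - normSq (mob A u) := by
      rw [← coe_smul_eq_mob]; exact one_sub_normSq_pos _
    have h5 : 0 < (1 - normSq (mob A z)) := by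
      rw [← coe_smul_eq_mob]; exact one_sub_normSq_pos _
    have h6 := normSq_nonneg (mob A z)
    have hJ0 : 0 ≤ J := by
      by_contra hJ0
      push Not at hJ0
      have := mul_pos h5 h4
      have := mul_pos_of_neg_of_neg hJ0 (neg_lt_zero.2 this)
      nlinarith [sq_nonneg (1 - r)]
    refine h3.trans (h1.trans ?_)
    gcongr
    nlinarith

lemma continuous_smul_PSU11 (γ : PSU11) : Continuous fun z : 𝔻 => γ • z := by
  induction γ using QuotientGroup.induction_on with
  | H A =>
    rw [UnitDisc.isEmbedding_coe.continuous_iff]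
    have h : ContinuousOn (mob A) (Metric.ball 0 1) := fun z hz =>
      (hasDerivAt_mob A (mem_ball_zero_iff.1 hz).le).continuousAt.continuousWithinAt
    exact h.comp_continuous UnitDisc.continuous_coe mem_ball_coe

/-- A cocompact group has a relatively compact set meeting all orbits. -/
lemma exists_radius (Γ : Subgroup PSU11) [CompactSpace (Quotient (MulAction.orbitRel Γ 𝔻))] :
    ∃ r : ℝ, 0 < r ∧ r < 1 ∧ ∀ z : 𝔻, ∃ γ : Γ, ‖((γ • z : 𝔻) : ℂ)‖ ≤ r := by
  have : ContinuousConstSMul Γ 𝔻 := ⟨fun γ => continuous_smul_PSU11 γ⟩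
  let q : 𝔻 → Quotient (MulAction.orbitRel Γ 𝔻) := Quotient.mk _
  -- The images of the balls of radius 1 - 1/(n + 2) are open and increasing, so compactness makes
  -- one of them the whole quotient.
  let U : ℕ → Set (Quotient (MulAction.orbitRel Γ 𝔻)) := fun n =>
    q '' {z : 𝔻 | ‖(z : ℂ)‖ < 1 - 1 / ((n : ℝ) + 2)}
  have hUo : ∀ n, IsOpen (U n) := fun n =>
    (isOpenMap_quotient_mk'_mul (Γ := Γ) (T := 𝔻)) _
      (isOpen_lt UnitDisc.continuous_coe.norm continuous_const)
  have hcov : (univ : Set (Quotient (MulAction.orbitRel Γ 𝔻))) ⊆ ⋃ n, U n := by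
    rintro x -
    obtain ⟨z, rfl⟩ := Quotient.exists_rep x
    obtain ⟨n, hn⟩ := exists_nat_gt (1 / (1 - ‖(z : ℂ)‖))
    refine mem_iUnion.2 ⟨n, z, ?_, rfl⟩
    have hz := sub_pos.2 z.norm_lt_one
    have hn' : 1 / (1 - ‖(z : ℂ)‖) < (n : ℝ) + 2 := by linarith
    rw [div_lt_iff₀ hz] at hn'
    have hp : (0 : ℝ) < (n : ℝ) + 2 := by positivity
    have : 1 / ((n : ℝ) + 2) < 1 - ‖(z : ℂ)‖ := by
      rw [div_lt_iff₀ hp]; linarith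
    change ‖(z : ℂ)‖ < _
    linarith
  have hmono : Monotone U := by
    intro m n hmn
    apply image_mono
    intro z hz
    refine lt_of_lt_of_le (show ‖(z : ℂ)‖ < _ from hz) ?_
    gcongr
  obtain ⟨n, hn⟩ := isCompact_univ.elim_directed_cover U hUo hcov hmono.directed_le
  have hp : (0 : ℝ) < (n : ℝ) + 2 := by positivity
  refine ⟨1 - 1 / ((n : ℝ) + 2), ?_, ?_, fun z => ?_⟩
  · rw [sub_pos, div_lt_one hp]; linarith [(Nat.cast_nonneg n : (0 : ℝ) ≤ n)]
  · have : 0 < 1 / ((n : ℝ) + 2) := by positivity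
    linarith
  · obtain ⟨y, hy, hyz⟩ := hn (mem_univ (q z))
    obtain ⟨γ, rfl⟩ := Quotient.exact hyz
    exact ⟨γ, (show ‖((γ • z : 𝔻) : ℂ)‖ < _ from hy).le⟩

/-! ### Proper discontinuity -/

lemma isCompact_bounded_SU11 (B : ℝ) :
    IsCompact {A : SU11 | ‖A.1 0 0‖ ≤ B ∧ ‖A.1 0 1‖ ≤ B} := by
  have hK : IsCompact {p : ℂ × ℂ | p ∈ Metric.closedBall (0 : ℂ) B ×ˢ Metric.closedBall (0 : ℂ) B ∧
      p.1 * conj p.1 - p.2 * conj p.2 = 1} :=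
    ((isCompact_closedBall 0 B).prod (isCompact_closedBall 0 B)).inter_right
      (isClosed_eq (by fun_prop) continuous_const)
  set K := {p : ℂ × ℂ | p ∈ Metric.closedBall (0 : ℂ) B ×ˢ Metric.closedBall (0 : ℂ) B ∧
      p.1 * conj p.1 - p.2 * conj p.2 = 1} with hKdef
  have : CompactSpace K := isCompact_iff_compactSpace.1 hK
  let f : K → SU11 := fun p =>
    ⟨⟨!![p.1.1, p.1.2; conj p.1.2, conj p.1.1], by
      rw [Matrix.det_fin_two_of]; exact p.2.2⟩, by
      constructor <;> simp⟩
  have hf : Continuous f := by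
    refine Continuous.subtype_mk (Continuous.subtype_mk ?_ _) _
    refine continuous_matrix fun i j => ?_
    fin_cases i <;> fin_cases j <;> simp <;> fun_prop
  convert isCompact_range hf
  ext A
  constructor
  · rintro ⟨h1, h2⟩
    refine ⟨⟨(A.1 0 0, A.1 0 1), ⟨mem_closedBall_zero_iff.2 h1, mem_closedBall_zero_iff.2 h2⟩,
      SU11_det A⟩, ?_⟩
    apply Subtype.ext
    apply Subtype.ext
    have h1 := SU11_c A
    have h2 := SU11_d A
    ext i j
    fin_cases i <;> fin_cases j <;> simp [f, h1, h2]
  · rintro ⟨p, rfl⟩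
    exact ⟨mem_closedBall_zero_iff.1 p.2.1.1, mem_closedBall_zero_iff.1 p.2.1.2⟩

/-- On one side |den| ≥ |a|(1 - ρ), because |b| < |a|. On the other, (1 - R²)|den|² ≤ 1 - |z|² ≤ 1,
because the image stays in the disk of radius R. -/
lemma norm_a_le (A : SU11) (z : 𝔻) {ρ R : ℝ} (hρ : ρ < 1) (hR0 : 0 ≤ R) (hR : R < 1)
    (hz : ‖(z : ℂ)‖ ≤ ρ) (hA : ‖mob A z‖ ≤ R) :
    ‖A.1 0 0‖ ^ 2 ≤ 1 / ((1 - R ^ 2) * (1 - ρ) ^ 2) := by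
  have h := one_sub_normSq_mob A z.norm_lt_one.le
  have hd := normSq_pos.2 (den_ne_zero A z.norm_lt_one.le)
  have h1 : ‖A.1 0 0‖ * (1 - ρ) ≤ ‖den A z‖ := by
    have := norm_sub_norm_le (A.1 1 1) (-(A.1 1 0 * z))
    rw [sub_neg_eq_add, add_comm, norm_neg, norm_mul, SU11_c, SU11_d, norm_conj, norm_conj,
      ← SU11_c, ← SU11_d] at this
    have hb := norm_b_lt_norm_a A
    have : ‖A.1 0 1‖ * ‖(z : ℂ)‖ ≤ ‖A.1 0 0‖ * ρ := by gcongr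
    simp only [den]
    linarith
  have hR2 : 0 < 1 - R ^ 2 := by nlinarith
  have h2 : (1 - R ^ 2) * normSq (den A z) ≤ 1 := by
    have h3 : normSq (mob A z) ≤ R ^ 2 := by rw [normSq_eq_norm_sq]; gcongr
    rw [eq_div_iff hd.ne'] at h
    have := normSq_nonneg (z : ℂ)
    nlinarith
  have hρ' : 0 < 1 - ρ := by linarith
  rw [le_div_iff₀ (by positivity)]
  have h4 : (‖A.1 0 0‖ * (1 - ρ)) ^ 2 ≤ normSq (den A z) := by
    rw [normSq_eq_norm_sq]; gcongr
  nlinarith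

/-- Such elements have matrices in a compact part of SU(1,1). Since {±1} is closed, PSU(1,1) is
Hausdorff, so the discrete subgroup Γ is closed and meets the compact image in a finite set. -/
lemma finite_smul_meets (Γ : Subgroup PSU11) [DiscreteTopology Γ] {ρ R : ℝ} (hρ : ρ < 1)
    (hR0 : 0 ≤ R) (hR : R < 1) :
    {γ : Γ | ∃ z : 𝔻, ‖(z : ℂ)‖ ≤ ρ ∧ ‖((γ • z : 𝔻) : ℂ)‖ ≤ R}.Finite := by
  have hcl : IsClosed (plusMinusOne : Set SU11) := by
    have : (plusMinusOne : Set SU11) = {A | A.1 = 1} ∪ {A | A.1 = -1} := rfl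
    rw [this]
    exact (isClosed_eq continuous_subtype_val continuous_const).union
      (isClosed_eq continuous_subtype_val continuous_const)
  have : T2Space PSU11 := inferInstance
  have hΓ : IsClosed (Γ : Set PSU11) := Subgroup.isClosed_of_discrete
  set B := 1 / ((1 - R ^ 2) * (1 - ρ) ^ 2) with hB
  have hc : IsCompact ((QuotientGroup.mk : SU11 → PSU11) ''
      {A : SU11 | ‖A.1 0 0‖ ≤ B + 1 ∧ ‖A.1 0 1‖ ≤ B + 1}) :=
    (isCompact_bounded_SU11 _).image QuotientGroup.continuous_mk
  have hfin := (hΓ.isClosedEmbedding_subtypeVal.isCompact_preimage hc).finite_of_discrete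
  refine hfin.subset ?_
  rintro ⟨γ, hγ⟩ ⟨z, hz, hz'⟩
  obtain ⟨A, rfl⟩ := QuotientGroup.mk_surjective γ
  refine ⟨A, ?_, rfl⟩
  have h := norm_a_le A z hρ hR0 hR hz hz'
  rw [← hB] at h
  -- `norm_a_le` bounds the square; the inequality 2|a| ≤ |a|² + 1 accounts for B + 1.
  have h1 : ‖A.1 0 0‖ ≤ B + 1 := by nlinarith [sq_nonneg (‖A.1 0 0‖ - 1)]
  exact ⟨h1, (norm_b_lt_norm_a A).le.trans h1⟩

/-! ### Wirtinger derivatives -/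

/-- The real-linear map `v ↦ p v + q conj v`. -/
def wirt (p q : ℂ) : ℂ →L[ℝ] ℂ :=
  p • ContinuousLinearMap.id ℝ ℂ + q • (conjCLE : ℂ →L[ℝ] ℂ)

lemma wirt_apply (p q v : ℂ) : wirt p q v = p * v + q * conj v := rfl

/-- `f` is real differentiable at `z`, with Wirtinger derivatives `∂f = p` and `∂̄f = q`. -/
def HasW (f : ℂ → ℂ) (p q z : ℂ) : Prop := HasFDerivAt f (wirt p q) z

lemma HasW.congr_deriv {f : ℂ → ℂ} {p q p' q' z : ℂ} (h : HasW f p q z) (hp : p = p')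
    (hq : q = q') : HasW f p' q' z := hp ▸ hq ▸ h

lemma hasW_const (c z : ℂ) : HasW (fun _ => c) 0 0 z :=
  (hasFDerivAt_const c z).congr_fderiv (by ext v; simp [wirt_apply])

lemma hasW_id (z : ℂ) : HasW (fun w => w) 1 0 z :=
  (hasFDerivAt_id z).congr_fderiv (by ext v; simp [wirt_apply])

lemma hasW_of_hasDerivAt {f : ℂ → ℂ} {p z : ℂ} (h : HasDerivAt f p z) : HasW f p 0 z :=
  (h.hasFDerivAt.restrictScalars ℝ).congr_fderiv (by ext v; simp [wirt_apply, mul_comm])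

lemma HasW.conj {f : ℂ → ℂ} {p q z : ℂ} (h : HasW f p q z) :
    HasW (fun w => conj (f w)) (conj q) (conj p) z :=
  ((conjCLE : ℂ →L[ℝ] ℂ).hasFDerivAt.comp z h).congr_fderiv (by
    ext v
    change (starRingEnd ℂ) (wirt p q v) = _
    simp [wirt_apply, add_comm])

lemma hasW_conj (z : ℂ) : HasW (fun w => conj w) 0 1 z := by
  simpa using (hasW_id z).conj

lemma HasW.add {f g : ℂ → ℂ} {p q p' q' z : ℂ} (h : HasW f p q z) (h' : HasW g p' q' z) :
    HasW (fun w => f w + g w) (p + p') (q + q') z :=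
  (HasFDerivAt.add h h').congr_fderiv (by
    ext v
    change wirt p q v + wirt p' q' v = _
    simp only [wirt_apply]; ring)

lemma HasW.mul {f g : ℂ → ℂ} {p q p' q' z : ℂ} (h : HasW f p q z) (h' : HasW g p' q' z) :
    HasW (fun w => f w * g w) (p * g z + f z * p') (q * g z + f z * q') z :=
  (HasFDerivAt.mul h h').congr_fderiv (by
    ext v
    change f z * wirt p' q' v + g z * wirt p q v = _
    simp only [wirt_apply]; ring)

lemma HasW.unique {f : ℂ → ℂ} {p q p' q' z : ℂ} (h : HasW f p q z) (h' : HasW f p' q' z) :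
    p = p' ∧ q = q' := by
  have e : wirt p q = wirt p' q' := HasFDerivAt.unique h h'
  have e1 : wirt p q 1 = wirt p' q' 1 := by rw [e]
  have e2 : wirt p q I = wirt p' q' I := by rw [e]
  simp only [wirt_apply, map_one, conj_I] at e1 e2
  have h1 : p = p' := by linear_combination e1 / 2 - I * e2 / 2 + (p - p' - q + q') / 2 * I_mul_I
  exact ⟨h1, by linear_combination e1 - h1⟩

lemma HasW.congr {f g : ℂ → ℂ} {p q z : ℂ} (h : HasW f p q z) (e : g =ᶠ[𝓝 z] f) : HasW g p q z :=
  HasFDerivAt.congr_of_eventuallyEq h e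

lemma hasW_of_differentiableAt {f : ℂ → ℂ} {z : ℂ} (h : DifferentiableAt ℝ f z) :
    HasW f ((fderiv ℝ f z 1 - I * fderiv ℝ f z I) / 2) ((fderiv ℝ f z 1 + I * fderiv ℝ f z I) / 2) z :=
  h.hasFDerivAt.congr_fderiv (by
    ext v
    have h1 : fderiv ℝ f z v = v.re * fderiv ℝ f z 1 + v.im * fderiv ℝ f z I := by
      calc fderiv ℝ f z v = fderiv ℝ f z (v.re • (1 : ℂ) + v.im • I) := by
            congr 1; apply Complex.ext <;> simp
        _ = _ := by rw [map_add, map_smul, map_smul, real_smul, real_smul]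
    have h2 : conj v = v.re - v.im * I := by apply Complex.ext <;> simp
    rw [h1, wirt_apply]
    linear_combination (fderiv ℝ f z 1 - I * fderiv ℝ f z I) / 2 * re_add_im v -
      (fderiv ℝ f z 1 + I * fderiv ℝ f z I) / 2 * h2 + v.im * fderiv ℝ f z I * I_mul_I)

lemma HasW.hasDerivAt {f : ℂ → ℂ} {p z : ℂ} (h : HasW f p 0 z) : HasDerivAt f p z := by
  rw [hasDerivAt_iff_hasFDerivAt]
  exact hasFDerivAt_of_restrictScalars ℝ h (by ext v; simp [wirt_apply, mul_comm])

lemma HasW.fderiv_apply {f : ℂ → ℂ} {p q z : ℂ} (h : HasW f p q z) (v : ℂ) :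
    fderiv ℝ f z v = p * v + q * conj v := by
  rw [HasFDerivAt.fderiv h, wirt_apply]

/-! ### Derivatives of the hyperbolic metric -/

lemma hasFDerivAt_normSq (z : ℂ) :
    HasFDerivAt (fun w => normSq w) ((2 * z.re) • reCLM + (2 * z.im) • imCLM) z := by
  have h := ((reCLM.hasFDerivAt (x := z)).mul (reCLM.hasFDerivAt (x := z))).add
    ((imCLM.hasFDerivAt (x := z)).mul (imCLM.hasFDerivAt (x := z)))
  refine h.congr_fderiv ?_
  ext <;> (simp; ring)

lemma fderiv_metric {z : ℂ} (hz : normSq z < 1) (u v e : ℂ) :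
    fderiv ℝ (fun w => metric w u v) z e =
      16 * (conj z * e).re / (1 - normSq z) ^ 3 * (u * conj v).re := by
  have h0 : 1 - normSq z ≠ 0 := (sub_pos.2 hz).ne'
  have h1 : HasFDerivAt (fun w => 1 - normSq w) (-((2 * z.re) • reCLM + (2 * z.im) • imCLM)) z :=
    (hasFDerivAt_normSq z).const_sub 1
  have h2 : HasDerivAt (fun x : ℝ => 4 / x ^ 2 * (u * conj v).re)
      (-8 / (1 - normSq z) ^ 3 * (u * conj v).re) (1 - normSq z) := by
    have := (((hasDerivAt_pow 2 (1 - normSq z)).inv (pow_ne_zero 2 h0)).const_mul 4).mul_const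
      (u * conj v).re
    refine (this.congr_deriv ?_)
    field_simp
    norm_num
    ring
  have h3 := h2.comp_hasFDerivAt z h1
  have h4 : (fun w => metric w u v) = (fun x : ℝ => 4 / x ^ 2 * (u * conj v).re) ∘
    fun w => 1 - normSq w := rfl
  rw [h4, h3.fderiv]
  simp
  ring

/-- For a conformal metric λ|dz|² the Christoffel map is complex bilinear with coefficient ∂ log λ,
here with λ = 4/(1 - |z|²)². -/
lemma christoffel_eq {z : ℂ} (hz : normSq z < 1) (u v : ℂ) :
    christoffel z u v = 2 * conj z / (1 - normSq z : ℝ) * (u * v) := by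
  have h0 : 1 - normSq z ≠ 0 := (sub_pos.2 hz).ne'
  have h0' : ((1 - normSq z : ℝ) : ℂ) ≠ 0 := ofReal_ne_zero.2 h0
  have hm : metric z 1 1 = 4 / (1 - normSq z) ^ 2 := by simp [metric]
  have e : 2 * conj z / (1 - normSq z : ℝ) * (u * v) =
      ((2 / (1 - normSq z) : ℝ) : ℂ) * (conj z * (u * v)) := by push_cast; ring
  rw [e]
  simp only [christoffel, fderiv_metric hz, hm]
  generalize 1 - normSq z = s at h0
  apply Complex.ext
  · rw [re_ofReal_mul]
    simp only [add_re, mul_re, mul_im, ofReal_re, ofReal_im, conj_re, conj_im,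
      I_re, I_im, one_re, one_im, map_one, conj_I, neg_re, neg_im]
    field_simp
    ring
  · rw [im_ofReal_mul]
    simp only [add_im, mul_re, mul_im, ofReal_re, ofReal_im, conj_re, conj_im,
      I_re, I_im, one_re, one_im, map_one, conj_I, neg_re, neg_im]
    field_simp
    ring

/-- The derivative of the conformal factor and the complex-linear part ∂ξ contribute only multiples
of the metric, so the trace-free part sees ∂̄ξ alone. -/
lemma quadDiff_eq {ξ : 𝔻 → ℂ} {z : 𝔻} {p q : ℂ} (h : HasW (extend ξ) p q z) :
    quadDiff ξ z = 8 / ((1 - normSq (z : ℂ) : ℝ) : ℂ) ^ 2 * conj q := by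
  have hz := z.normSq_lt_one
  have e : 8 / ((1 - normSq (z : ℂ) : ℝ) : ℂ) ^ 2 * conj q =
      ((8 / (1 - normSq (z : ℂ)) ^ 2 : ℝ) : ℂ) * conj q := by push_cast; ring
  rw [e]
  simp only [quadDiff, lieMetric, fderiv_metric hz, h.fderiv_apply]
  simp only [metric]
  apply Complex.ext
  · rw [re_ofReal_mul]
    simp only [add_re, add_im, sub_re, mul_re, mul_im, ofReal_re, ofReal_im, conj_re, conj_im,
      I_re, I_im, one_re, one_im, map_one, conj_I, neg_re, neg_im]
    ring
  · rw [im_ofReal_mul]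
    simp only [add_re, add_im, sub_im, mul_re, mul_im, ofReal_re, ofReal_im, conj_re, conj_im,
      I_re, I_im, one_re, one_im, map_one, conj_I, neg_re, neg_im]
    ring

/-! ### Killing fields -/

lemma eq_const_of_deriv_zero {f : ℂ → ℂ} (h : ∀ z ∈ Metric.ball (0 : ℂ) 1, HasDerivAt f 0 z) {z : ℂ}
    (hz : z ∈ Metric.ball (0 : ℂ) 1) : f z = f 0 :=
  Metric.isOpen_ball.is_const_of_deriv_eq_zero (convex_ball (0 : ℂ) 1).isPreconnected
    (fun w hw => (h w hw).differentiableAt.differentiableWithinAt) (fun w hw => (h w hw).deriv) hz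
    (Metric.mem_ball_self one_pos)

lemma eq_quadratic_of_deriv {f f' f'' : ℂ → ℂ}
    (h : ∀ z ∈ Metric.ball (0 : ℂ) 1, HasDerivAt f (f' z) z)
    (h' : ∀ z ∈ Metric.ball (0 : ℂ) 1, HasDerivAt f' (f'' z) z)
    (h'' : ∀ z ∈ Metric.ball (0 : ℂ) 1, HasDerivAt f'' 0 z) {z : ℂ}
    (hz : z ∈ Metric.ball (0 : ℂ) 1) : f z = f 0 + f' 0 * z + f'' 0 / 2 * z ^ 2 := by
  have e2 : ∀ w ∈ Metric.ball (0 : ℂ) 1, f'' w = f'' 0 := fun w => eq_const_of_deriv_zero h''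
  have e1 : ∀ w ∈ Metric.ball (0 : ℂ) 1, f' w = f' 0 + f'' 0 * w := by
    intro w hw
    have := eq_const_of_deriv_zero (f := fun w => f' w - f'' 0 * w) (fun v hv => by
      have := (h' v hv).sub ((hasDerivAt_id v).const_mul (f'' 0))
      refine this.congr_deriv ?_
      rw [e2 v hv]; ring) hw
    simp only [mul_zero, sub_zero] at this
    linear_combination this
  have := eq_const_of_deriv_zero (f := fun w => f w - f' 0 * w - f'' 0 / 2 * w ^ 2) (fun v hv => by
      have := ((h v hv).sub ((hasDerivAt_id v).const_mul (f' 0))).sub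
        ((hasDerivAt_pow 2 v).const_mul (f'' 0 / 2))
      refine this.congr_deriv ?_
      rw [e1 v hv]
      simp
      ring) hz
  simp only [mul_zero, sub_zero, ne_eq, OfNat.ofNat_ne_zero, not_false_eq_true, zero_pow] at this
  linear_combination this

/-- The trace-free part of the Killing equation is ∂̄ξ = 0; its trace is the displayed identity. -/
lemma hasDerivAt_of_killing {ξ : 𝔻 → ℂ} (hξ : ξ ∈ killing) (z : 𝔻) :
    HasDerivAt (extend ξ) (deriv (extend ξ) z) z ∧
      (1 - z * conj (z : ℂ)) * (deriv (extend ξ) z + conj (deriv (extend ξ) z)) +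
        2 * (conj (z : ℂ) * extend ξ z + z * conj (extend ξ z)) = 0 := by
  have hw := hasW_of_differentiableAt (hξ.1.differentiableAt z)
  set p := (fderiv ℝ (extend ξ) z 1 - I * fderiv ℝ (extend ξ) z I) / 2
  set q := (fderiv ℝ (extend ξ) z 1 + I * fderiv ℝ (extend ξ) z I) / 2
  have hs : ((1 - normSq (z : ℂ) : ℝ) : ℂ) ≠ 0 := ofReal_ne_zero.2 (sub_pos.2 z.normSq_lt_one).ne'
  have hq : q = 0 := by
    have h1 : quadDiff ξ z = 0 := by simp [quadDiff, hξ.2]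
    rw [quadDiff_eq hw, mul_eq_zero, div_eq_zero_iff] at h1
    rcases h1 with (h1 | h1) | h1
    · norm_num at h1
    · exact absurd h1 (pow_ne_zero 2 hs)
    · simpa using h1
  rw [hq] at hw
  have hd := hw.hasDerivAt
  rw [hd.deriv]
  refine ⟨hd, ?_⟩
  have h2 := hξ.2 z 1 1
  have hs' : 1 - normSq (z : ℂ) ≠ 0 := (sub_pos.2 z.normSq_lt_one).ne'
  simp only [lieMetric, fderiv_metric z.normSq_lt_one, hw.fderiv_apply] at h2
  simp only [metric] at h2
  simp only [map_one, mul_one, one_re, add_zero, one_mul, conj_re] at h2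
  field_simp at h2
  rw [extend_coe, mul_conj, add_conj]
  have e : conj (z : ℂ) * ξ z + z * conj (ξ z) = (2 * (conj (z : ℂ) * ξ z).re : ℝ) := by
    rw [← add_conj]; simp
  rw [e]
  norm_cast
  linarith

/-- Killing fields on the disk are the quadratic polynomials `a + i b z - conj a z²`, `b` real. -/
lemma killing_eq {ξ : 𝔻 → ℂ} (hξ : ξ ∈ killing) :
    ∃ a : ℂ, ∃ b : ℝ, ∀ z : 𝔻, ξ z = a + b * I * z - conj a * (z : ℂ) ^ 2 := by
  set F := extend ξ
  set F1 := deriv F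
  set F2 := deriv F1
  have hF : ∀ z ∈ Metric.ball (0 : ℂ) 1, HasDerivAt F (F1 z) z ∧
      (1 - z * conj z) * (F1 z + conj (F1 z)) + 2 * (conj z * F z + z * conj (F z)) = 0 :=
    fun z hz => hasDerivAt_of_killing hξ (UnitDisc.mk z (mem_ball_zero_iff.1 hz))
  have hd : DifferentiableOn ℂ F (Metric.ball 0 1) := fun z hz =>
    (hF z hz).1.differentiableAt.differentiableWithinAt
  have hd1 : DifferentiableOn ℂ F1 (Metric.ball 0 1) := hd.deriv Metric.isOpen_ball
  have hd2 : DifferentiableOn ℂ F2 (Metric.ball 0 1) := hd1.deriv Metric.isOpen_ball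
  have nb : ∀ {z : ℂ}, z ∈ Metric.ball (0 : ℂ) 1 → Metric.ball (0 : ℂ) 1 ∈ 𝓝 z := fun hz =>
    Metric.isOpen_ball.mem_nhds hz
  have hF1 : ∀ z ∈ Metric.ball (0 : ℂ) 1, HasDerivAt F1 (F2 z) z := fun z hz =>
    (hd1.differentiableAt (nb hz)).hasDerivAt
  have hF2 : ∀ z ∈ Metric.ball (0 : ℂ) 1, HasDerivAt F2 (deriv F2 z) z := fun z hz =>
    (hd2.differentiableAt (nb hz)).hasDerivAt
  have hs : ∀ z : ℂ, HasW (fun w => 1 + (-1) * (w * conj w)) (- conj z) (- z) z := fun z =>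
    ((hasW_const 1 z).add ((hasW_const (-1) z).mul ((hasW_id z).mul (hasW_conj z)))).congr_deriv
      (by ring) (by ring)
  -- Apply ∂ to the trace identity, treating z̄ and the conjugated holomorphic functions as
  -- constants. A second ∂ then leaves (1 - |z|²)F''' = 0.
  have hG1 : ∀ z ∈ Metric.ball (0 : ℂ) 1, conj z * (F1 z + (-1) * conj (F1 z)) +
      (1 + (-1) * (z * conj z)) * F2 z + 2 * conj (F z) = 0 := by
    intro z hz
    have w0 := hasW_of_hasDerivAt (hF z hz).1
    have w1 := hasW_of_hasDerivAt (hF1 z hz)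
    have h := ((hs z).mul (w1.add w1.conj)).add ((hasW_const 2 z).mul
      (((hasW_conj z).mul w0).add ((hasW_id z).mul w0.conj)))
    have h0 := ((hasW_const 0 z).congr (Filter.eventuallyEq_of_mem (nb hz) fun w hw => by
      linear_combination (hF w hw).2)).unique h
    linear_combination (norm := skip) - h0.1
    simp
    ring
  have hG2 : ∀ z ∈ Metric.ball (0 : ℂ) 1, deriv F2 z = 0 := by
    intro z hz
    have w0 := hasW_of_hasDerivAt (hF z hz).1
    have w1 := hasW_of_hasDerivAt (hF1 z hz)
    have w2 := hasW_of_hasDerivAt (hF2 z hz)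
    have h := (((hasW_conj z).mul (w1.add ((hasW_const (-1) z).mul w1.conj))).add
      ((hs z).mul w2)).add ((hasW_const 2 z).mul w0.conj)
    have h0 := ((hasW_const 0 z).congr (Filter.eventuallyEq_of_mem (nb hz) fun w hw => by
      linear_combination hG1 w hw)).unique h
    have h1 : (1 - z * conj z) * deriv F2 z = 0 := by
      linear_combination (norm := skip) - h0.1
      simp
      ring
    refine (mul_eq_zero.1 h1).resolve_left ?_
    rw [mul_conj]
    have := (UnitDisc.mk z (mem_ball_zero_iff.1 hz)).normSq_lt_one
    rw [UnitDisc.coe_mk] at this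
    exact_mod_cast (sub_pos.2 this).ne'
  have key := fun z hz => eq_quadratic_of_deriv (fun z hz => (hF z hz).1) hF1
    (fun z hz => hG2 z hz ▸ hF2 z hz) (z := z) hz
  have h0 : (0 : ℂ) ∈ Metric.ball (0 : ℂ) 1 := Metric.mem_ball_self one_pos
  -- At the origin the two identities read Re F'(0) = 0 and F''(0) = -2 conj F(0), which fixes the
  -- coefficients.
  have e1 := (hF 0 h0).2
  have e2 := hG1 0 h0
  simp only [map_zero, mul_zero, zero_mul, sub_zero, add_zero, one_mul, zero_add] at e1 e2
  refine ⟨F 0, (F1 0).im, fun z => ?_⟩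
  have e3 : F1 0 = ((F1 0).im : ℂ) * I := by
    rw [add_conj] at e1
    apply Complex.ext
    · have := congrArg re e1
      simpa using this
    · simp
  rw [← extend_coe ξ z]
  change F z = _
  rw [key z (mem_ball_coe z), ← e3]
  linear_combination (z : ℂ) ^ 2 / 2 * e2

/-! ### The tension field and harmonic vector fields -/

lemma christoffel_one_add_I {z : ℂ} (hz : normSq z < 1) :
    christoffel z 1 1 + christoffel z I I = 0 := by
  rw [christoffel_eq hz, christoffel_eq hz, I_mul_I]; ring

/-- The frame sum of second derivatives is 4∂∂̄φ, that of the quadratic term is proportional to 4∂φ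
∂̄φ, and the term dφ(Γ) cancels because 1² + i² = 0. The mixed derivative of ξ appears once as p' =
∂̄P and once as q = ∂Q, so no symmetry of second derivatives is needed. -/
lemma tension_add_smul {ξ P Q φ : ℂ → ℂ} {z p p' q q' : ℂ} {t : ℝ} (hz : z ∈ Metric.ball (0 : ℂ) 1)
    (hξ : ∀ w ∈ Metric.ball (0 : ℂ) 1, HasW ξ (P w) (Q w) w)
    (hP : HasW P p p' z) (hQ : HasW Q q q' z) (hφ : φ =ᶠ[𝓝 z] fun w => w + t * ξ w)
    (hφz : normSq (φ z) < 1) :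
    tension φ z = (1 / metric z 1 1 : ℝ) * (t * (2 * p' + 2 * q) +
      2 * conj (φ z) / (1 - normSq (φ z) : ℝ) * (4 * (1 + t * P z) * (t * Q z))) := by
  have hz' : normSq z < 1 := (UnitDisc.mk z (mem_ball_zero_iff.1 hz)).normSq_lt_one
  have hb : ∀ᶠ w in 𝓝 z, w ∈ Metric.ball (0 : ℂ) 1 := Metric.isOpen_ball.mem_nhds hz
  have h1 : ∀ᶠ w in 𝓝 z, HasW φ (1 + t * P w) (t * Q w) w := by
    filter_upwards [hφ.eventuallyEq_nhds, hb] with w hw hwb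
    exact (((hasW_id w).add ((hasW_const (t : ℂ) w).mul (hξ w hwb))).congr_deriv (by ring)
      (by ring)).congr hw
  have h2 : ∀ e : ℂ, HasW (fun w => fderiv ℝ φ w e) (t * (p * e + q * conj e))
      (t * (p' * e + q' * conj e)) z := by
    intro e
    have h := (((hasW_const 1 z).add ((hasW_const (t : ℂ) z).mul hP)).mul (hasW_const e z)).add
      (((hasW_const (t : ℂ) z).mul hQ).mul (hasW_const (conj e) z))
    refine (h.congr_deriv (by ring) (by ring)).congr ?_
    filter_upwards [h1] with w hw
    rw [hw.fderiv_apply]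
  have h3 : fderiv ℝ φ z (christoffel z I I) = - fderiv ℝ φ z (christoffel z 1 1) := by
    rw [← map_neg, eq_neg_of_add_eq_zero_right (christoffel_one_add_I hz')]
  have h4 := h1.self_of_nhds
  simp only [tension]
  congr 1
  rw [h3, (h2 1).fderiv_apply, (h2 I).fderiv_apply, christoffel_eq hφz, christoffel_eq hφz]
  simp only [h4.fderiv_apply, map_one, conj_I]
  linear_combination (t * (p - p' - q + q') + 2 * conj (φ z) / (1 - normSq (φ z) : ℝ) *
    (1 + t * P z - t * Q z) ^ 2) * I_mul_I

/-- The tension is t·g(t) with g continuous, and g(0) = 0 is exactly the linearised equation ∂∂̄ξ =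
-2z̄ ∂̄ξ/(1 - |z|²). -/
lemma hasDerivWithinAt_tension {ξ P Q : ℂ → ℂ} {φ : ℝ → ℂ → ℂ} {z p q' : ℂ}
    (hz : z ∈ Metric.ball (0 : ℂ) 1)
    (hξ : ∀ w ∈ Metric.ball (0 : ℂ) 1, HasW ξ (P w) (Q w) w)
    (hP : HasW P p (-2 * conj z * Q z / (1 - normSq z : ℝ)) z)
    (hQ : HasW Q (-2 * conj z * Q z / (1 - normSq z : ℝ)) q' z)
    (hφ : ∀ᶠ t in 𝓝[≥] (0 : ℝ), φ t =ᶠ[𝓝 z] fun w => w + t * ξ w) :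
    HasDerivWithinAt (fun t => tension (φ t) z) 0 (Ici 0) 0 := by
  have hz' : normSq z < 1 := (UnitDisc.mk z (mem_ball_zero_iff.1 hz)).normSq_lt_one
  have hs : ((1 - normSq z : ℝ) : ℂ) ≠ 0 := ofReal_ne_zero.2 (sub_pos.2 hz').ne'
  set k := -2 * conj z * Q z / (1 - normSq z : ℝ) with hk
  let f : ℝ → ℂ := fun t => z + t * ξ z
  have hf : Continuous f := by fun_prop
  let g : ℝ → ℂ := fun t => (1 / metric z 1 1 : ℝ) * ((2 * k + 2 * k) +
      2 * conj (f t) / (1 - normSq (f t) : ℝ) * (4 * (1 + t * P z) * Q z))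
  have hg : ContinuousAt g 0 := by
    have h0 : ((1 - normSq (f 0) : ℝ) : ℂ) ≠ 0 := by simpa [f] using hs
    have hc : Continuous fun t => ((1 - normSq (f t) : ℝ) : ℂ) :=
      continuous_ofReal.comp (continuous_const.sub (continuous_normSq.comp hf))
    have hc' : Continuous fun t => 2 * conj (f t) := by fun_prop
    have := hc'.continuousAt.div hc.continuousAt h0
    fun_prop
  have hg0 : g 0 = 0 := by
    simp only [g, f, hk, ofReal_zero, zero_mul, add_zero]
    field_simp
    ring
  have hd : HasDerivAt (fun t : ℝ => (t : ℂ) * g t) 0 0 := by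
    rw [hasDerivAt_iff_tendsto_slope]
    have h1 : Tendsto g (𝓝[≠] 0) (𝓝 0) := by
      rw [← hg0]; exact hg.tendsto.mono_left nhdsWithin_le_nhds
    refine h1.congr' ?_
    filter_upwards [self_mem_nhdsWithin] with t ht
    have ht : (t : ℂ) ≠ 0 := ofReal_ne_zero.2 ht
    simp only [slope, vsub_eq_sub, sub_zero, ofReal_zero, zero_mul, real_smul, ofReal_inv]
    field_simp
  have hn : ∀ᶠ t in 𝓝[≥] (0 : ℝ), normSq (f t) < 1 := by
    have : ∀ᶠ t in 𝓝 (0 : ℝ), normSq (f t) < 1 :=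
      (continuous_normSq.comp hf).continuousAt.eventually_lt continuousAt_const
        (by simpa [f] using hz')
    exact this.filter_mono nhdsWithin_le_nhds
  have key : ∀ᶠ t in 𝓝[≥] (0 : ℝ), tension (φ t) z = t * g t := by
    filter_upwards [hφ, hn] with t ht hnt
    have e : φ t z = f t := ht.self_of_nhds
    rw [tension_add_smul hz hξ hP hQ ht (by rw [e]; exact hnt), e]
    simp only [g]
    ring
  exact hd.hasDerivWithinAt.congr_of_eventuallyEq key (key.self_of_nhdsWithin self_mem_Ici)

lemma contDiff_normSq : ContDiff ℝ ∞ (fun w : ℂ => normSq w) := by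
  have : (fun w : ℂ => normSq w) = fun w => ‖w‖ ^ 2 := funext fun w => normSq_eq_norm_sq w
  rw [this]
  exact contDiff_norm_sq ℝ

/-- The family z + tξ may leave the disk, since ξ need not be bounded. A smooth cutoff depending on
t and z stops the motion where it becomes dangerous, yet near any given point it equals 1 for all
small t, so derivatives at t = 0 are unaffected. -/
lemma isHarmonic_of_hasW {ξ : 𝔻 → ℂ} (hs : IsSmooth ξ) {P Q : ℂ → ℂ}
    (hξ : ∀ w ∈ Metric.ball (0 : ℂ) 1, HasW (extend ξ) (P w) (Q w) w)
    (hP : ∀ z ∈ Metric.ball (0 : ℂ) 1, ∃ p, HasW P p (-2 * conj z * Q z / (1 - normSq z : ℝ)) z)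
    (hQ : ∀ z ∈ Metric.ball (0 : ℂ) 1, ∃ q, HasW Q (-2 * conj z * Q z / (1 - normSq z : ℝ)) q z) :
    IsHarmonic ξ := by
  have hpos : ∀ z ∈ Metric.ball (0 : ℂ) 1, 0 < 1 - normSq z := fun z hz =>
    one_sub_normSq_pos (UnitDisc.mk z (mem_ball_zero_iff.1 hz))
  -- If tM < 1 then t|ξ| ≤ t(1 + |ξ|²) < (1 - |z|²)/2 ≤ 1 - |z|, so z + tξ stays in the disk. The
  -- cutoff χ is 1 for tM ≤ 1/2 and 0 for tM ≥ 1.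
  let M : ℂ → ℝ := fun z => 2 * (1 + normSq (extend ξ z)) / (1 - normSq z)
  have hM0 : ∀ z ∈ Metric.ball (0 : ℂ) 1, 0 < M z := fun z hz =>
    div_pos (by linarith [normSq_nonneg (extend ξ z)]) (hpos z hz)
  have hM : ContDiffOn ℝ ∞ M (Metric.ball 0 1) := by
    refine ContDiffOn.div ?_ ?_ fun z hz => (hpos z hz).ne'
    · exact contDiffOn_const.mul (contDiffOn_const.add (contDiff_normSq.comp_contDiffOn hs))
    · exact contDiffOn_const.sub contDiff_normSq.contDiffOn
  let χ : ℝ → ℂ → ℝ := fun t z => Real.smoothTransition (2 - 2 * (t * M z))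
  have hχ : ContDiffOn ℝ ∞ (fun p : ℝ × ℂ => χ p.1 p.2) (univ ×ˢ Metric.ball 0 1) := by
    refine Real.smoothTransition.contDiff.comp_contDiffOn ?_
    refine contDiffOn_const.sub (contDiffOn_const.mul (contDiff_fst.contDiffOn.mul ?_))
    exact hM.comp contDiff_snd.contDiffOn fun p hp => hp.2
  have hχ1 : ∀ z ∈ Metric.ball (0 : ℂ) 1, ∀ᶠ t in 𝓝[≥] (0 : ℝ), ∀ᶠ w in 𝓝 z, χ t w = 1 := by
    intro z hz
    have h1 : ∀ᶠ w in 𝓝 z, M w < M z + 1 :=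
      (hM.continuousOn.continuousAt (Metric.isOpen_ball.mem_nhds hz)).eventually_lt
        continuousAt_const (by linarith)
    have h3 : 0 < 1 / (2 * (M z + 1)) := by
      have := hM0 z hz
      positivity
    filter_upwards [self_mem_nhdsWithin, mem_nhdsWithin_of_mem_nhds (Iio_mem_nhds h3)] with t ht ht'
    filter_upwards [h1, Metric.isOpen_ball.mem_nhds hz] with w hw hwb
    apply Real.smoothTransition.one_of_one_le
    have ht' : t < 1 / (2 * (M z + 1)) := ht'
    have ht : 0 ≤ t := ht
    have := hM0 z hz
    rw [lt_div_iff₀ (by positivity)] at ht'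
    have : t * M w ≤ t * (M z + 1) := by gcongr
    linarith
  let φ : ℝ → ℂ → ℂ := fun t z => z + (t * χ t z : ℝ) * extend ξ z
  have hφ1 : ∀ z ∈ Metric.ball (0 : ℂ) 1, ∀ᶠ t in 𝓝[≥] (0 : ℝ),
      φ t =ᶠ[𝓝 z] fun w => w + t * extend ξ w := by
    intro z hz
    filter_upwards [hχ1 z hz] with t ht
    filter_upwards [ht] with w hw
    simp only [φ, hw, mul_one]
  refine ⟨hs, 1, one_pos, φ, ?_, ?_, ?_, ?_, ?_⟩
  · have hsub : Ico (0 : ℝ) 1 ×ˢ Metric.ball (0 : ℂ) 1 ⊆ univ ×ˢ Metric.ball 0 1 :=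
      prod_mono (subset_univ _) subset_rfl
    refine ContDiffOn.mono ?_ hsub
    refine contDiff_snd.contDiffOn.add (ContDiffOn.mul ?_ ?_)
    · exact ofRealCLM.contDiff.comp_contDiffOn (contDiff_fst.contDiffOn.mul hχ)
    · exact hs.comp contDiff_snd.contDiffOn fun p hp => hp.2
  · intro t ht z hz
    have hz1 := mem_ball_zero_iff.1 hz
    rw [mem_ball_zero_iff]
    have h1 : ‖φ t z‖ ≤ ‖z‖ + t * χ t z * ‖extend ξ z‖ := by
      refine (norm_add_le _ _).trans (le_of_eq ?_)
      rw [norm_mul, norm_real, Real.norm_of_nonneg (mul_nonneg ht.1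
        (Real.smoothTransition.nonneg _))]
    rcases le_or_gt 1 (t * M z) with h | h
    · have : χ t z = 0 := Real.smoothTransition.zero_of_nonpos (by linarith)
      rw [this] at h1
      linarith
    · have h2 : χ t z ≤ 1 := Real.smoothTransition.le_one _
      have h3 : t * χ t z * ‖extend ξ z‖ ≤ t * ‖extend ξ z‖ := by
        have := mul_le_mul_of_nonneg_left h2 (mul_nonneg ht.1 (norm_nonneg (extend ξ z)))
        linarith
      have hp := hpos z hz
      rw [← mul_div_assoc, div_lt_one hp, normSq_eq_norm_sq, normSq_eq_norm_sq] at h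
      have h4 : t * ‖extend ξ z‖ ≤ t * (1 + ‖extend ξ z‖ ^ 2) := by
        have := ht.1
        gcongr
        nlinarith [sq_nonneg (‖extend ξ z‖ - 1)]
      nlinarith [norm_nonneg z]
  · intro z; simp [φ]
  · intro z
    have h1 : HasDerivAt (fun t : ℝ => (z : ℂ) + t * extend ξ z) (ξ z) 0 := by
      have := ((ofRealCLM.hasDerivAt (x := (0 : ℝ))).mul_const (extend ξ z)).const_add (z : ℂ)
      simpa [extend_coe] using this
    have key : ∀ᶠ t in 𝓝[≥] (0 : ℝ), φ t z = z + t * extend ξ z := by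
      filter_upwards [hφ1 z (mem_ball_coe z)] with t ht
      exact ht.self_of_nhds
    exact h1.hasDerivWithinAt.congr_of_eventuallyEq key (key.self_of_nhdsWithin self_mem_Ici)
  · intro z
    obtain ⟨p, hp⟩ := hP z (mem_ball_coe z)
    obtain ⟨q, hq⟩ := hQ z (mem_ball_coe z)
    exact hasDerivWithinAt_tension (mem_ball_coe z) hξ hp hq (hφ1 z (mem_ball_coe z))

/-! ### Cauchy-type integrals over the circle -/

instance : IsProbabilityMeasure arc := inferInstanceAs (IsProbabilityMeasure AddCircle.haarAddCircle)

@[fun_prop]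
lemma continuous_pt : Continuous pt := continuous_subtype_val.comp AddCircle.continuous_toCircle

lemma norm_pt (θ : AddCircle (2 * Real.pi)) : ‖pt θ‖ = 1 := Circle.norm_coe _

lemma pt_mul_conj (θ : AddCircle (2 * Real.pi)) : pt θ * conj (pt θ) = 1 := by
  rw [mul_conj, normSq_eq_norm_sq, norm_pt]; simp

lemma pt_coe (t : ℝ) : pt (t : AddCircle (2 * Real.pi)) = circleMap 0 1 t := by
  simp [pt, AddCircle.toCircle_apply_mk, circleMap]

lemma integral_arc (f : ℂ → ℂ) : ∫ θ, f (pt θ) ∂arc = Real.circleAverage f 0 1 := by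
  rw [arc, AddCircle.integral_haarAddCircle, Real.circleAverage,
    ← AddCircle.intervalIntegral_preimage (2 * Real.pi) 0]
  simp only [pt_coe, zero_add]

lemma norm_one_sub_conj_mul_ge {w z : ℂ} (hw : ‖w‖ = 1) : 1 - ‖z‖ ≤ ‖1 - conj w * z‖ := by
  have := norm_sub_norm_le 1 (conj w * z)
  rwa [norm_one, norm_mul, norm_conj, hw, one_mul] at this

lemma one_sub_conj_mul_ne_zero {w z : ℂ} (hw : ‖w‖ = 1) (hz : ‖z‖ < 1) : 1 - conj w * z ≠ 0 := by
  have := norm_one_sub_conj_mul_ge (z := z) hw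
  exact norm_pos_iff.1 (by linarith)

/-- The Cauchy-type integral `∫ Y(w) (1 - conj w z)⁻ᵏ`. -/
def cauchyInt (Y : AddCircle (2 * Real.pi) → ℂ) (k : ℕ) (z : ℂ) : ℂ :=
  ∫ θ, Y θ * ((1 - conj (pt θ) * z)⁻¹) ^ k ∂arc

lemma continuous_inv_one_sub {z : ℂ} (hz : ‖z‖ < 1) (k : ℕ) :
    Continuous fun θ => ((1 - conj (pt θ) * z)⁻¹) ^ k := by
  refine Continuous.pow (Continuous.inv₀ (by fun_prop) fun θ => ?_) k
  exact one_sub_conj_mul_ne_zero (norm_pt θ) hz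

lemma norm_inv_one_sub_le {w z : ℂ} (hw : ‖w‖ = 1) {r : ℝ} (hr : r < 1) (hz : ‖z‖ ≤ r) (k : ℕ) :
    ‖((1 - conj w * z)⁻¹) ^ k‖ ≤ ((1 - r)⁻¹) ^ k := by
  rw [norm_pow, norm_inv]
  have h := norm_one_sub_conj_mul_ge (z := z) hw
  have : 0 < 1 - r := by linarith
  gcongr
  linarith

lemma integrable_cauchy {Y : AddCircle (2 * Real.pi) → ℂ} (hY : Integrable Y arc) {z : ℂ}
    (hz : ‖z‖ < 1) (k : ℕ) : Integrable (fun θ => Y θ * ((1 - conj (pt θ) * z)⁻¹) ^ k) arc :=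
  hY.mul_bdd (continuous_inv_one_sub hz k).aestronglyMeasurable
    (Eventually.of_forall fun θ => norm_inv_one_sub_le (norm_pt θ) hz le_rfl k)

lemma integrable_mul_conj {Y : AddCircle (2 * Real.pi) → ℂ} (hY : Integrable Y arc) :
    Integrable (fun θ => Y θ * conj (pt θ)) arc :=
  hY.mul_bdd (c := 1) (by fun_prop : Continuous fun θ => conj (pt θ)).aestronglyMeasurable
    (Eventually.of_forall fun θ => by rw [norm_conj, norm_pt])

lemma hasDerivAt_cauchyInt {Y : AddCircle (2 * Real.pi) → ℂ} (hY : Integrable Y arc) (k : ℕ) {z : ℂ}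
    (hz : ‖z‖ < 1) :
    HasDerivAt (cauchyInt Y k) (k * cauchyInt (fun θ => Y θ * conj (pt θ)) (k + 1) z) z := by
  obtain ⟨r, hzr, hr⟩ := exists_between hz
  have hball : ∀ w ∈ Metric.ball (0 : ℂ) r, ‖w‖ < 1 := fun w hw =>
    (mem_ball_zero_iff.1 hw).trans hr
  have hs : Metric.ball (0 : ℂ) r ∈ 𝓝 z := Metric.isOpen_ball.mem_nhds (mem_ball_zero_iff.2 hzr)
  have h := hasDerivAt_integral_of_dominated_loc_of_deriv_le (μ := arc) (x₀ := z) hs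
    (F := fun z θ => Y θ * ((1 - conj (pt θ) * z)⁻¹) ^ k)
    (F' := fun z θ => k * ((Y θ * conj (pt θ)) * ((1 - conj (pt θ) * z)⁻¹) ^ (k + 1)))
    (bound := fun θ => k * (‖Y θ‖ * ((1 - r)⁻¹) ^ (k + 1)))
    (by filter_upwards [hs] with w hw using (integrable_cauchy hY (hball w hw) k).1)
    (integrable_cauchy hY hz k)
    ((integrable_cauchy (integrable_mul_conj hY) hz (k + 1)).const_mul (k : ℂ)).1
    (Eventually.of_forall fun θ w hw => by
      rw [norm_mul, norm_mul, norm_mul, norm_conj, norm_pt, mul_one, norm_natCast]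
      have := norm_inv_one_sub_le (norm_pt θ) hr (mem_ball_zero_iff.1 hw).le (k + 1)
      gcongr)
    ((hY.norm.mul_const _).const_mul _)
    (Eventually.of_forall fun θ w hw => by
      have h0 := one_sub_conj_mul_ne_zero (norm_pt θ) (hball w hw)
      have h1 : HasDerivAt (fun z => 1 - conj (pt θ) * z) (-conj (pt θ)) w := by
        simpa using ((hasDerivAt_id w).const_mul (conj (pt θ))).const_sub 1
      refine (((h1.inv h0).pow k).const_mul (Y θ)).congr_deriv ?_
      rcases k with - | k
      · simp
      · simp only [Nat.add_sub_cancel, Pi.inv_apply]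
        rw [div_eq_mul_inv, ← inv_pow]
        ring)
  refine h.2.congr_deriv ?_
  rw [integral_const_mul]
  rfl

/-- Integrates x^(k+1) - x^k = w̄z x^(k+1) for x = (1 - w̄z)⁻¹. It expresses z times the derivative
of a Cauchy-type integral through two consecutive ones, which drives the telescoping below. -/
lemma cauchyInt_succ_sub {Y : AddCircle (2 * Real.pi) → ℂ} (hY : Integrable Y arc) (k : ℕ) {z : ℂ}
    (hz : ‖z‖ < 1) :
    cauchyInt Y (k + 1) z - cauchyInt Y k z =
      z * cauchyInt (fun θ => Y θ * conj (pt θ)) (k + 1) z := by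
  rw [cauchyInt, cauchyInt, cauchyInt, ← integral_sub (integrable_cauchy hY hz _)
    (integrable_cauchy hY hz _), ← integral_const_mul]
  refine integral_congr_ae (Eventually.of_forall fun θ => ?_)
  have h0 := one_sub_conj_mul_ne_zero (norm_pt θ) hz
  linear_combination Y θ * (1 - conj (pt θ) * z)⁻¹ ^ k * inv_mul_cancel₀ h0

lemma differentiableOn_cauchyInt {Y : AddCircle (2 * Real.pi) → ℂ} (hY : Integrable Y arc) (k : ℕ) :
    DifferentiableOn ℂ (cauchyInt Y k) (Metric.ball 0 1) := fun _ hz =>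
  (hasDerivAt_cauchyInt hY k (mem_ball_zero_iff.1 hz)).differentiableAt.differentiableWithinAt

lemma contDiffOn_cauchyInt {Y : AddCircle (2 * Real.pi) → ℂ} (hY : Integrable Y arc) (k : ℕ) :
    ContDiffOn ℝ ∞ (cauchyInt Y k) (Metric.ball 0 1) :=
  ((differentiableOn_cauchyInt hY k).contDiffOn Metric.isOpen_ball).restrict_scalars ℝ

lemma integrable_conj {Y : AddCircle (2 * Real.pi) → ℂ} (hY : Integrable Y arc) :
    Integrable (fun θ => conj (Y θ)) arc :=
  (conjCLE : ℂ →L[ℝ] ℂ).integrable_comp hY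

lemma integrable_CircleL2 (X : CircleL2) : Integrable X arc := (Lp.memLp X).integrable one_le_two

/-! ### The Poisson map -/

/-- The holomorphic functions `V_k(z) = ∫ conj (Y(w)) conj w (1 - conj w z)⁻ᵏ`. -/
def conjCauchy (Y : AddCircle (2 * Real.pi) → ℂ) (k : ℕ) : ℂ → ℂ :=
  cauchyInt (fun θ => conj (Y θ) * conj (pt θ)) k

/-- The Poisson integral in terms of holomorphic functions. -/
def poissonFun (Y : AddCircle (2 * Real.pi) → ℂ) (z : ℂ) : ℂ :=
  cauchyInt Y 1 z + conj (z * (conjCauchy Y 1 z + (1 + -1 * (z * conj z)) * conjCauchy Y 2 z +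
    ((1 + -1 * (z * conj z)) * (1 + -1 * (z * conj z))) * conjCauchy Y 3 z))

/-- Put a = 1 - w̄z, b = ā and s = 1 - |z|². The kernel is X s³/(ab³), and s - b = a w z̄. Factoring
s³ - b³ gives s³/(ab³) = 1/a + w z̄ (1/b + s/b² + s²/b³). -/
lemma kernel_eq {X w z : ℂ} (hw : ‖w‖ = 1) (hz : ‖z‖ < 1) :
    X / (I * w) * (w * poissonKernel (w⁻¹ * z)) =
      X * (1 - conj w * z)⁻¹ ^ 1 + conj (z * (conj X * conj w * (1 - conj w * z)⁻¹ ^ 1 +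
        (1 + -1 * (z * conj z)) * (conj X * conj w * (1 - conj w * z)⁻¹ ^ 2) +
        ((1 + -1 * (z * conj z)) * (1 + -1 * (z * conj z))) *
          (conj X * conj w * (1 - conj w * z)⁻¹ ^ 3))) := by
  have hw0 : w ≠ 0 := norm_pos_iff.1 (by rw [hw]; exact one_pos)
  have hww : w * conj w = 1 := by rw [mul_conj, normSq_eq_norm_sq, hw]; simp
  have hinv : w⁻¹ = conj w := inv_eq_of_mul_eq_one_right hww
  have h1 := one_sub_conj_mul_ne_zero hw hz
  have h2 : 1 - w * conj z ≠ 0 := by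
    have := (map_ne_zero (starRingEnd ℂ)).2 h1
    simpa using this
  have e1 : ((‖conj w * z‖ ^ 2 : ℝ) : ℂ) = z * conj z := by
    rw [norm_mul, norm_conj, hw, one_mul, ← normSq_eq_norm_sq, mul_conj]
  have e2 : ((‖1 - conj (conj w * z)‖ ^ 2 : ℝ) : ℂ) = (1 - w * conj z) * (1 - conj w * z) := by
    rw [← normSq_eq_norm_sq, ← mul_conj]; simp
  rw [poissonKernel, hinv, ofReal_sub, e1, e2]
  simp only [map_add, map_mul, map_sub, map_one, map_neg, map_inv₀, map_pow, conj_conj, ofReal_one]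
  obtain ⟨a, ha⟩ : ∃ a, a = 1 - conj w * z := ⟨_, rfl⟩
  obtain ⟨b, hb⟩ : ∃ b, b = 1 - w * conj z := ⟨_, rfl⟩
  rw [← ha] at h1 ⊢
  rw [← hb] at h2 ⊢
  field_simp
  rw [ha, hb]
  linear_combination (X * conj z * ((1 - w * conj z) ^ 2 + (1 - z * conj z) * (1 - w * conj z) +
    (1 - z * conj z) ^ 2) * z) * hww

lemma poissonMap_eq (X : CircleL2) (z : 𝔻) : poissonMap X z = poissonFun X z := by
  have hX := integrable_CircleL2 X
  have hV := integrable_mul_conj (integrable_conj hX)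
  have hz := z.norm_lt_one
  simp only [poissonMap, poissonFun, conjCauchy, cauchyInt]
  rw [← integral_const_mul, ← integral_const_mul, ← integral_add, ← integral_add,
    ← integral_const_mul, ← integral_conj, ← integral_add]
  · exact integral_congr_ae (Eventually.of_forall fun θ => kernel_eq (norm_pt θ) hz)
  · exact integrable_cauchy hX hz 1
  · exact integrable_conj ((((integrable_cauchy hV hz 1).add
      ((integrable_cauchy hV hz 2).const_mul _)).add
      ((integrable_cauchy hV hz 3).const_mul _)).const_mul _)
  · exact (integrable_cauchy hV hz 1).add ((integrable_cauchy hV hz 2).const_mul _)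
  · exact (integrable_cauchy hV hz 3).const_mul _
  · exact integrable_cauchy hV hz 1
  · exact (integrable_cauchy hV hz 2).const_mul _

lemma contDiffOn_poissonFun {Y : AddCircle (2 * Real.pi) → ℂ} (hY : Integrable Y arc) :
    ContDiffOn ℝ ∞ (poissonFun Y) (Metric.ball 0 1) := by
  have hV := integrable_mul_conj (integrable_conj hY)
  have hc : ContDiff ℝ ∞ (fun z : ℂ => conj z) := (conjCLE : ℂ →L[ℝ] ℂ).contDiff
  have hs : ContDiffOn ℝ ∞ (fun z : ℂ => 1 + -1 * (z * conj z)) (Metric.ball 0 1) :=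
    (contDiff_const.add (contDiff_const.mul (contDiff_id.mul hc))).contDiffOn
  refine (contDiffOn_cauchyInt hY 1).add (hc.comp_contDiffOn (contDiffOn_id.mul ?_))
  exact ((contDiffOn_cauchyInt hV 1).add (hs.mul (contDiffOn_cauchyInt hV 2))).add
    ((hs.mul hs).mul (contDiffOn_cauchyInt hV 3))

lemma isSmooth_poissonMap (X : CircleL2) : IsSmooth (poissonMap X) :=
  (contDiffOn_poissonFun (integrable_CircleL2 X)).congr (eqOn_extend (poissonMap_eq X))

section Derivatives

variable {Y : AddCircle (2 * Real.pi) → ℂ}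

lemma hasW_defect (z : ℂ) : HasW (fun w => 1 + -1 * (w * conj w)) (- conj z) (- z) z :=
  ((hasW_const 1 z).add ((hasW_const (-1) z).mul ((hasW_id z).mul (hasW_conj z)))).congr_deriv
    (by ring) (by ring)

lemma hasW_conjCauchy (hY : Integrable Y arc) (k : ℕ) {z : ℂ} (hz : ‖z‖ < 1) :
    ∃ d, z * d = conjCauchy Y (k + 1) z - conjCauchy Y k z ∧
      HasW (conjCauchy Y k) (k * d) 0 z := by
  have hV := integrable_mul_conj (integrable_conj hY)
  exact ⟨_, (cauchyInt_succ_sub hV k hz).symm, hasW_of_hasDerivAt (hasDerivAt_cauchyInt hV k hz)⟩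

/-- Write s = 1 - |z|² and V_k for `conjCauchy Y k`. In ∂(z(V₁ + sV₂ + s²V₃)) the rule z V_k' =
k(V_{k+1} - V_k) cancels V₁, V₂ and V₃, and only 3s²V₄ survives. -/
lemma hasW_poissonFun (hY : Integrable Y arc) {z : ℂ} (hz : ‖z‖ < 1) :
    HasW (poissonFun Y) (cauchyInt (fun θ => Y θ * conj (pt θ)) 2 z +
      conj (-1 * (z * z) * (conjCauchy Y 2 z + 2 * (1 + -1 * (z * conj z)) * conjCauchy Y 3 z)))
      (conj (3 * ((1 + -1 * (z * conj z)) * (1 + -1 * (z * conj z))) * conjCauchy Y 4 z)) z := by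
  obtain ⟨d1, e1, h1⟩ := hasW_conjCauchy hY 1 hz
  obtain ⟨d2, e2, h2⟩ := hasW_conjCauchy hY 2 hz
  obtain ⟨d3, e3, h3⟩ := hasW_conjCauchy hY 3 hz
  have hh := hasW_of_hasDerivAt (hasDerivAt_cauchyInt hY 1 hz)
  have hs := hasW_defect z
  have h := hh.add ((hasW_id z).mul ((h1.add (hs.mul h2)).add ((hs.mul hs).mul h3))).conj
  refine h.congr_deriv ?_ ?_
  · simp only [Nat.cast_one, one_mul]
    congr 1
    rw [show (1 : ℕ) + 1 = 2 from rfl] at *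
    congr 1
    ring
  · rw [zero_add]
    congr 1
    push_cast
    linear_combination e1 + 2 * (1 + -1 * (z * conj z)) * e2 +
      3 * ((1 + -1 * (z * conj z)) * (1 + -1 * (z * conj z))) * e3

/-- Since ∂̄ξ is s² times an antiholomorphic function, with s = 1 - |z|², applying ∂ multiplies it
by -2z̄/s: this is the linearised harmonic map equation. -/
lemma isHarmonic_poissonMap (X : CircleL2) : IsHarmonic (poissonMap X) := by
  have hX := integrable_CircleL2 X
  have hz1 : ∀ z ∈ Metric.ball (0 : ℂ) 1, ‖z‖ < 1 := fun z hz => mem_ball_zero_iff.1 hz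
  refine isHarmonic_of_hasW (isSmooth_poissonMap X)
    (P := fun z => cauchyInt (fun θ => X θ * conj (pt θ)) 2 z +
      conj (-1 * (z * z) * (conjCauchy X 2 z + 2 * (1 + -1 * (z * conj z)) * conjCauchy X 3 z)))
    (Q := fun z => conj (3 * ((1 + -1 * (z * conj z)) * (1 + -1 * (z * conj z))) *
      conjCauchy X 4 z)) ?_ ?_ ?_
  · intro z hz
    exact (hasW_poissonFun hX (hz1 z hz)).congr
      (eventuallyEq_extend (poissonMap_eq X) (UnitDisc.mk z (hz1 z hz)))
  all_goals
    intro z hz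
    have hs := hasW_defect z
    have e : ((1 - normSq z : ℝ) : ℂ) = 1 + -1 * (z * conj z) := by
      rw [mul_conj]; push_cast; ring
    have hne : 1 + -1 * (z * conj z) ≠ 0 := by
      rw [← e]
      exact ofReal_ne_zero.2 (one_sub_normSq_pos (UnitDisc.mk z (hz1 z hz))).ne'
    have e2 : ∀ v : ℂ, -2 * conj z * conj (3 * ((1 + -1 * (z * conj z)) * (1 + -1 * (z * conj z))) * v) /
        (1 - normSq z : ℝ) = conj (-6 * (1 + -1 * (z * conj z)) * z * v) := by
      intro v
      rw [e, div_eq_iff hne]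
      simp only [map_mul, map_add, map_neg, map_one, conj_conj, map_ofNat]
      ring
    rw [e2]
  · have hh := hasW_of_hasDerivAt (hasDerivAt_cauchyInt (integrable_mul_conj hX) 2 (hz1 z hz))
    obtain ⟨d2, e2, h2⟩ := hasW_conjCauchy hX 2 (hz1 z hz)
    obtain ⟨d3, e3, h3⟩ := hasW_conjCauchy hX 3 (hz1 z hz)
    have h := hh.add ((((hasW_const (-1) z).mul ((hasW_id z).mul (hasW_id z))).mul
      (h2.add (((hasW_const 2 z).mul hs).mul h3))).conj)
    refine ⟨_, h.congr_deriv rfl ?_⟩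
    rw [zero_add]
    congr 1
    push_cast
    linear_combination -2 * z * e2 - 6 * (1 + -1 * (z * conj z)) * z * e3
  · obtain ⟨d4, e4, h4⟩ := hasW_conjCauchy hX 4 (hz1 z hz)
    have h := (((hasW_const 3 z).mul (hs.mul hs)).mul h4).conj
    refine ⟨_, h.congr_deriv ?_ rfl⟩
    congr 1
    ring

lemma quadDiff_poissonMap (X : CircleL2) (z : 𝔻) :
    quadDiff (poissonMap X) z = 24 * conjCauchy X 4 z := by
  have h := (hasW_poissonFun (integrable_CircleL2 X) z.norm_lt_one).congr
    (eventuallyEq_extend (poissonMap_eq X) z)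
  have e : ((1 - normSq (z : ℂ) : ℝ) : ℂ) = 1 + -1 * (z * conj (z : ℂ)) := by
    rw [mul_conj]; push_cast; ring
  have hne : 1 + -1 * (z * conj (z : ℂ)) ≠ 0 := by
    rw [← e]
    exact ofReal_ne_zero.2 (one_sub_normSq_pos z).ne'
  rw [quadDiff_eq h, conj_conj, e]
  generalize 1 + -1 * (z * conj (z : ℂ)) = s at hne
  field_simp
  ring

end Derivatives

lemma differentiableOn_quadDiff_poissonMap (X : CircleL2) :
    DifferentiableOn ℂ (extend (quadDiff (poissonMap X))) (Metric.ball 0 1) :=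
  ((differentiableOn_cauchyInt (integrable_mul_conj (integrable_conj (integrable_CircleL2 X)))
    4).const_mul 24).congr (eqOn_extend (quadDiff_poissonMap X))

/-- For a tangential field, `quadDiff` of the Poisson map in terms of the field itself. -/
lemma conjCauchy_of_tangential {Y : AddCircle (2 * Real.pi) → ℂ} {F : ℂ → ℂ}
    (hYF : ∀ᵐ θ ∂arc, Y θ = F (pt θ)) (hF : ∀ w, ‖w‖ = 1 → conj (F w) = - F w * conj w ^ 2) (z : ℂ) :
    conjCauchy Y 4 z =
      -Real.circleAverage (fun w => F w * conj w ^ 3 * (1 - conj w * z)⁻¹ ^ 4) 0 1 := by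
  rw [← integral_arc, ← integral_neg]
  refine integral_congr_ae ?_
  filter_upwards [hYF] with θ h
  rw [h, hF _ (norm_pt θ)]
  ring

/-- The integrand is the conjugate of a holomorphic function vanishing at 0, so the mean value
property applies. -/
lemma circleAverage_pow_mul_eq_zero {n : ℕ} (hn : n ≠ 0) {z : ℂ} (hz : ‖z‖ < 1) :
    Real.circleAverage (fun w => conj w ^ n * (1 - conj w * z)⁻¹ ^ 4) 0 1 = 0 := by
  have h : DiffContOnCl ℂ (fun w : ℂ => w ^ n * (1 - w * conj z)⁻¹ ^ 4) (Metric.ball 0 |1|) := by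
    refine DifferentiableOn.diffContOnCl fun w hw => ?_
    rw [abs_one, closure_ball _ one_ne_zero, mem_closedBall_zero_iff] at hw
    have : 1 - w * conj z ≠ 0 := by
      intro h
      have h1 : ‖w * conj z‖ = 1 := by rw [← sub_eq_zero.1 h, norm_one]
      rw [norm_mul, norm_conj] at h1
      nlinarith [norm_nonneg w, norm_nonneg z]
    apply DifferentiableAt.differentiableWithinAt
    fun_prop (disch := assumption)
  have h1 := h.circleAverage
  rw [zero_pow hn, zero_mul] at h1
  rw [← integral_arc] at h1 ⊢
  have h2 := congrArg conj h1
  rw [← integral_conj, map_zero] at h2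
  rw [← h2]
  congr 1
  ext θ
  simp

/-- The Cauchy-type integral giving the quadratic differential vanishes on quadratic polynomials. -/
lemma circleAverage_quadratic (a b c : ℂ) {z : ℂ} (hz : ‖z‖ < 1) :
    Real.circleAverage (fun w => (a + b * w + c * w ^ 2) * conj w ^ 3 * (1 - conj w * z)⁻¹ ^ 4) 0 1 =
      0 := by
  have key : ∀ n : ℕ, Integrable (fun θ => conj (pt θ) ^ n * (1 - conj (pt θ) * z)⁻¹ ^ 4) arc :=
    fun n => integrable_cauchy (Continuous.integrable_of_hasCompactSupport (by fun_prop)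
      (HasCompactSupport.of_compactSpace _)) hz 4
  -- As w w̄ = 1, the factor w̄³ turns 1, w, w² into w̄³, w̄², w̄. All exponents stay positive,
  -- which is why degree two is the limit.
  have e : ∀ θ, (a + b * pt θ + c * pt θ ^ 2) * conj (pt θ) ^ 3 * (1 - conj (pt θ) * z)⁻¹ ^ 4 =
      a * (conj (pt θ) ^ 3 * (1 - conj (pt θ) * z)⁻¹ ^ 4) +
      b * (conj (pt θ) ^ 2 * (1 - conj (pt θ) * z)⁻¹ ^ 4) +
      c * (conj (pt θ) ^ 1 * (1 - conj (pt θ) * z)⁻¹ ^ 4) := by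
    intro θ
    have h := pt_mul_conj θ
    linear_combination (b * conj (pt θ) ^ 2 + c * conj (pt θ) * (pt θ * conj (pt θ) + 1)) *
      (1 - conj (pt θ) * z)⁻¹ ^ 4 * h
  have h0 : ∀ n : ℕ, n ≠ 0 → ∫ θ, conj (pt θ) ^ n * (1 - conj (pt θ) * z)⁻¹ ^ 4 ∂arc = 0 :=
    fun n hn => by
      rw [integral_arc fun w => conj w ^ n * (1 - conj w * z)⁻¹ ^ 4]
      exact circleAverage_pow_mul_eq_zero hn hz
  rw [← integral_arc]
  simp only [e]
  rw [integral_add, integral_add, integral_const_mul, integral_const_mul, integral_const_mul,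
    h0 3 (by norm_num), h0 2 (by norm_num), h0 1 (by norm_num)]
  · simp
  · exact (key 3).const_mul a
  · exact (key 2).const_mul b
  · exact ((key 3).const_mul a).add ((key 2).const_mul b)
  · exact (key 1).const_mul c

/-! ### Smooth potentials of cocycles -/

lemma extend_mul (ψ φ : 𝔻 → ℂ) : extend (ψ * φ) = extend ψ * extend φ := by
  funext z; by_cases h : ‖z‖ < 1 <;> simp [extend, h]

lemma IsSmooth.mul {ψ φ : 𝔻 → ℂ} (hψ : IsSmooth ψ) (hφ : IsSmooth φ) : IsSmooth (ψ * φ) := by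
  rw [IsSmooth, extend_mul]; exact ContDiffOn.mul hψ hφ

lemma IsSmooth.add {ψ φ : 𝔻 → ℂ} (hψ : IsSmooth ψ) (hφ : IsSmooth φ) : IsSmooth (ψ + φ) := by
  rw [IsSmooth, extend_add]; exact ContDiffOn.add hψ hφ

lemma IsSmooth.const_smul {ψ : 𝔻 → ℂ} (hψ : IsSmooth ψ) (r : ℝ) : IsSmooth (r • ψ) := by
  rw [IsSmooth, extend_const_smul]; exact ContDiffOn.const_smul r hψ

lemma IsSmooth.div {ψ φ : 𝔻 → ℂ} (hψ : IsSmooth ψ) (hφ : IsSmooth φ) (h0 : ∀ z, φ z ≠ 0) :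
    IsSmooth (fun z => ψ z / φ z) := by
  have h1 : ContDiffOn ℝ ∞ (fun z => extend ψ z * (extend φ z)⁻¹) (Metric.ball 0 1) := by
    refine ContDiffOn.mul hψ (ContDiffOn.inv (f := extend φ) hφ fun z hz => ?_)
    rw [extend_mk _ (mem_ball_zero_iff.1 hz)]
    exact h0 _
  exact h1.congr (eqOn_extend fun z => by rw [extend_coe, extend_coe, div_eq_mul_inv])

lemma IsSmooth.sum {ι : Type*} (s : Finset ι) {ψ : ι → 𝔻 → ℂ} (h : ∀ i ∈ s, IsSmooth (ψ i)) :
    IsSmooth (fun z => ∑ i ∈ s, ψ i z) := by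
  refine ContDiffOn.congr (f := fun z => ∑ i ∈ s, extend (ψ i) z) (ContDiffOn.sum h) ?_
  exact eqOn_extend fun z => by simp only [extend_coe]

lemma isSmooth_of_local {ψ : 𝔻 → ℂ}
    (h : ∀ ρ < (1 : ℝ), ∃ φ : 𝔻 → ℂ, IsSmooth φ ∧ ∀ z : 𝔻, ‖(z : ℂ)‖ ≤ ρ → ψ z = φ z) :
    IsSmooth ψ := by
  intro z hz
  have hz1 := mem_ball_zero_iff.1 hz
  obtain ⟨ρ, hzρ, hρ⟩ := exists_between hz1
  obtain ⟨φ, hφ, e⟩ := h ρ hρ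
  have h1 : extend ψ =ᶠ[𝓝 z] extend φ := by
    filter_upwards [Metric.isOpen_ball.mem_nhds (mem_ball_zero_iff.2 hzρ)] with w hw
    have hw := mem_ball_zero_iff.1 hw
    rw [extend_mk _ (hw.trans hρ), extend_mk _ (hw.trans hρ)]
    exact e _ hw.le
  exact ((hφ.contDiffAt (Metric.isOpen_ball.mem_nhds hz)).congr_of_eventuallyEq h1).contDiffWithinAt

/-- A smooth bump function supported in the disk of radius `R`. -/
def bump (R : ℝ) (z : 𝔻) : ℂ := (expNegInvGlue (R ^ 2 - normSq (z : ℂ)) : ℝ)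

lemma bump_eq_zero {R : ℝ} (hR : 0 ≤ R) {z : 𝔻} (hz : R < ‖(z : ℂ)‖) : bump R z = 0 := by
  have h : R ^ 2 ≤ ‖(z : ℂ)‖ ^ 2 := by gcongr
  rw [bump, expNegInvGlue.zero_of_nonpos (by rw [normSq_eq_norm_sq]; linarith), ofReal_zero]

lemma isSmooth_bump_smul (R : ℝ) (γ : PSU11) : IsSmooth (fun z => bump R (γ • z)) := by
  induction γ using QuotientGroup.induction_on with
  | H A =>
    have h1 : ContDiffOn ℝ ∞ (mob A) (Metric.ball 0 1) := by
      have : DifferentiableOn ℂ (mob A) (Metric.ball 0 1) := fun z hz =>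
        (hasDerivAt_mob A (mem_ball_zero_iff.1 hz).le).differentiableAt.differentiableWithinAt
      exact (this.contDiffOn Metric.isOpen_ball).restrict_scalars ℝ
    have h2 : ContDiffOn ℝ ∞ (fun w => ((expNegInvGlue (R ^ 2 - normSq (mob A w)) : ℝ) : ℂ))
        (Metric.ball 0 1) :=
      ofRealCLM.contDiff.comp_contDiffOn (expNegInvGlue.contDiff.comp_contDiffOn
        (contDiffOn_const.sub (contDiff_normSq.comp_contDiffOn h1)))
    exact h2.congr (eqOn_extend fun z => by rw [bump, coe_smul_eq_mob])

section Potential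

variable (Γ : Subgroup PSU11) [DiscreteTopology Γ]

lemma exists_finset_bump {ρ R : ℝ} (hρ : ρ < 1) (hR0 : 0 ≤ R) (hR : R < 1) :
    ∃ T : Finset Γ, ∀ z : 𝔻, ‖(z : ℂ)‖ ≤ ρ → ∀ γ : Γ, bump R (γ • z) ≠ 0 → γ ∈ T := by
  refine ⟨(finite_smul_meets Γ hρ hR0 hR).toFinset, fun z hz γ h => ?_⟩
  rw [Set.Finite.mem_toFinset]
  refine ⟨z, hz, ?_⟩
  by_contra hlt
  exact h (bump_eq_zero hR0 (not_le.1 hlt))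

lemma finite_support_bump {R : ℝ} (hR0 : 0 ≤ R) (hR : R < 1) (f : Γ → ℂ) (z : 𝔻) :
    (Function.support fun γ : Γ => bump R (γ • z) * f γ).Finite := by
  obtain ⟨T, hT⟩ := exists_finset_bump Γ z.norm_lt_one hR0 hR
  exact T.finite_toSet.subset fun γ hγ => hT z le_rfl γ (left_ne_zero_of_mul hγ)

lemma isSmooth_finsum_bump {R : ℝ} (hR0 : 0 ≤ R) (hR : R < 1) {f : Γ → 𝔻 → ℂ}
    (hf : ∀ γ, IsSmooth (f γ)) : IsSmooth fun z => ∑ᶠ γ : Γ, bump R (γ • z) * f γ z := by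
  refine isSmooth_of_local fun ρ hρ => ?_
  obtain ⟨T, hT⟩ := exists_finset_bump Γ hρ hR0 hR
  refine ⟨fun z => ∑ γ ∈ T, bump R (γ • z) * f γ z,
    IsSmooth.sum T fun γ _ => (isSmooth_bump_smul R (γ : PSU11)).mul (hf γ), fun z hz => ?_⟩
  exact finsum_eq_sum_of_support_subset _ fun γ hγ => hT z hz γ (left_ne_zero_of_mul hγ)

lemma isSmooth_const (a : ℂ) : IsSmooth fun _ => a :=
  (contDiffOn_const (c := a)).congr (eqOn_extend fun _ => rfl)

/-- S is Γ-invariant, while reindexing η ↦ ηγ and the cocycle relation give γ^*N = N - S c_γ. Hence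
-N/S has coboundary c. -/
theorem exists_potential [CompactSpace (Quotient (MulAction.orbitRel Γ 𝔻))] (c : Z1 Γ) :
    ∃ ψ : 𝔻 → ℂ, IsSmooth ψ ∧ ∀ γ : Γ, (c.1 γ : 𝔻 → ℂ) = coboundary Γ ψ γ := by
  classical
  obtain ⟨r, hr0, hr1, hr⟩ := exists_radius Γ
  -- The bump must be strictly positive on the closed disk of radius r, so its support radius is
  -- taken larger than r.
  obtain ⟨R, hrR, hR1⟩ := exists_between hr1
  have hR0 : 0 ≤ R := hr0.le.trans hrR.le
  let S : 𝔻 → ℂ := fun z => ∑ᶠ γ : Γ, bump R (γ • z) * 1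
  let N : 𝔻 → ℂ := fun z => ∑ᶠ γ : Γ, bump R (γ • z) * (c.1 γ : 𝔻 → ℂ) z
  have hS : IsSmooth S := isSmooth_finsum_bump Γ hR0 hR1 fun _ => isSmooth_const 1
  have hN : IsSmooth N := isSmooth_finsum_bump Γ hR0 hR1 fun γ => (c.1 γ).2.1
  have hS0 : ∀ z, S z ≠ 0 := by
    intro z
    obtain ⟨γ, hγ⟩ := hr z
    obtain ⟨T, hT⟩ := exists_finset_bump Γ z.norm_lt_one hR0 hR1
    have h1 : S z = ((∑ η ∈ insert γ T,
        expNegInvGlue (R ^ 2 - normSq ((η • z : 𝔻) : ℂ)) : ℝ) : ℂ) := by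
      rw [ofReal_sum]
      simp only [S, mul_one]
      refine finsum_eq_sum_of_support_subset _ fun η hη => ?_
      exact Finset.mem_coe.2 (Finset.mem_insert_of_mem (hT z le_rfl η hη))
    rw [h1, ofReal_ne_zero]
    refine (Finset.sum_pos' (fun η _ => expNegInvGlue.nonneg _)
      ⟨γ, Finset.mem_insert_self _ _, expNegInvGlue.pos_of_pos ?_⟩).ne'
    rw [normSq_eq_norm_sq, sub_pos]
    have := hγ.trans_lt hrR
    gcongr
  refine ⟨fun z => -1 * (N z / S z), (isSmooth_const (-1)).mul (hN.div hS hS0), fun γ => ?_⟩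
  funext z
  have hmul : ∀ η : Γ, η • γ • z = (η * γ) • z := fun η => (mul_smul η γ z).symm
  have e1 : S (γ • z) = S z := by
    simp only [S, hmul]
    exact finsum_comp_equiv (Equiv.mulRight γ) (f := fun η : Γ => bump R (η • z) * 1)
  have e2 : N (γ • z) * (mobDeriv γ z)⁻¹ = N z - S z * (c.1 γ : 𝔻 → ℂ) z := by
    have h1 : ∀ η : Γ, bump R (η • γ • z) * (c.1 η : 𝔻 → ℂ) (γ • z) * (mobDeriv γ z)⁻¹ =
        bump R ((η * γ) • z) * ((c.1 (η * γ) : 𝔻 → ℂ) z - (c.1 γ : 𝔻 → ℂ) z) := by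
      intro η
      rw [hmul, c.2 η γ z, add_sub_cancel_right, mul_assoc]
      rfl
    simp only [N, S]
    rw [finsum_mul, finsum_mul, finsum_congr h1]
    refine (finsum_comp_equiv (Equiv.mulRight γ)
      (f := fun η : Γ => bump R (η • z) * ((c.1 η : 𝔻 → ℂ) z - (c.1 γ : 𝔻 → ℂ) z))).trans ?_
    rw [← finsum_sub_distrib (finite_support_bump Γ hR0 hR1 _ _)]
    · exact finsum_congr fun η => by ring
    · simp only [mul_assoc]
      exact finite_support_bump Γ hR0 hR1 _ _
  have h0 := hS0 z
  change (c.1 γ : 𝔻 → ℂ) z =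
    -1 * (N (γ • z) / S (γ • z)) * (mobDeriv γ z)⁻¹ - -1 * (N z / S z)
  rw [e1]
  have e3 : -1 * (N (γ • z) / S z) * (mobDeriv γ z)⁻¹ =
      -1 * (N (γ • z) * (mobDeriv γ z)⁻¹ / S z) := by ring
  rw [e3, e2]
  field_simp
  ring

end Potential

/-! ### Dyadic estimates -/

lemma dyadic_induction {P : ℝ → Prop} (h0 : ∀ s, 1 / 2 ≤ s → s ≤ 1 → P s)
    (h1 : ∀ s, 0 < s → s ≤ 1 → P s → P (s / 2)) {s : ℝ} (hs : 0 < s) (hs1 : s ≤ 1) : P s := by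
  have key : ∀ n : ℕ, ∀ s : ℝ, (1 / 2) ^ (n + 1) ≤ s → s ≤ 1 → P s := by
    intro n
    induction n with
    | zero => intro s hs hs1; exact h0 s (by simpa using hs) hs1
    | succ n ih =>
      intro s hs hs1
      rcases le_or_gt (1 / 2) s with h | h
      · exact h0 s h hs1
      · have hpos : (0 : ℝ) < (1 / 2) ^ (n + 1) := by positivity
        have h2 : (1 / 2) ^ (n + 1) ≤ 2 * s := by rw [pow_succ] at hs; linarith
        have := h1 (2 * s) (by linarith) (by linarith) (ih (2 * s) h2 (by linarith))
        rwa [mul_div_cancel_left₀ s two_ne_zero] at this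
  obtain ⟨n, hn⟩ := exists_pow_lt_of_lt_one hs (by norm_num : (1 / 2 : ℝ) < 1)
  exact key n s ((pow_le_pow_of_le_one (by norm_num) (by norm_num) (Nat.le_succ n)).trans hn.le) hs1

lemma le_sqrt_half {s : ℝ} (hs : 0 ≤ s) : 7 / 10 * √s ≤ √(s / 2) := by
  apply Real.le_sqrt_of_sq_le
  nlinarith [Real.sq_sqrt hs]

lemma sqrt_half_le {s : ℝ} (hs : 0 ≤ s) : √(s / 2) ≤ 71 / 100 * √s := by
  rw [Real.sqrt_le_left (by positivity)]
  nlinarith [Real.sq_sqrt hs]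

lemma le_sqrt_self {s : ℝ} (hs : 0 ≤ s) (hs1 : s ≤ 1) : s ≤ √s := by
  apply Real.le_sqrt_of_sq_le
  nlinarith

/-- Halving s divides the main term by four, whereas the claimed bound only has to halve; the error
A s fits into the surplus. -/
lemma norm_le_of_four_mul {g : ℝ → ℂ} {B A : ℝ} (hA : 0 ≤ A)
    (h0 : ∀ s, 1 / 2 ≤ s → s ≤ 1 → ‖g s‖ ≤ B)
    (h1 : ∀ s, 0 < s → s ≤ 1 → ‖g s - 4 * g (s / 2)‖ ≤ A * s) {s : ℝ} (hs : 0 < s) (hs1 : s ≤ 1) :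
    ‖g s‖ ≤ (2 * B + A) * s := by
  have hB : 0 ≤ B := (norm_nonneg _).trans (h0 1 (by norm_num) le_rfl)
  refine dyadic_induction (P := fun s => ‖g s‖ ≤ (2 * B + A) * s) ?_ ?_ hs hs1
  · intro s hs hs1
    have := h0 s hs hs1
    nlinarith
  · intro s hs hs1 ih
    have h2 := h1 s hs hs1
    have h3 : ‖4 * g (s / 2)‖ ≤ ‖g s‖ + ‖g s - 4 * g (s / 2)‖ := by
      have := norm_sub_le (g s) (g s - 4 * g (s / 2))
      rwa [sub_sub_cancel] at this
    rw [norm_mul, Complex.norm_ofNat] at h3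
    nlinarith

/-- Here the factor two resonates with the error A s: iteration would produce s log(1/s). The weaker
order √s absorbs the logarithm, as √(1/2) ≥ 7/10 > 1/2. -/
lemma norm_le_of_two_mul {f : ℝ → ℂ} {B A : ℝ} (hA : 0 ≤ A)
    (h0 : ∀ s, 1 / 2 ≤ s → s ≤ 1 → ‖f s‖ ≤ B)
    (h1 : ∀ s, 0 < s → s ≤ 1 → ‖f s - 2 * f (s / 2)‖ ≤ A * s) {s : ℝ} (hs : 0 < s) (hs1 : s ≤ 1) :
    ‖f s‖ ≤ (2 * B + 3 * A) * √s := by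
  have hB : 0 ≤ B := (norm_nonneg _).trans (h0 1 (by norm_num) le_rfl)
  refine dyadic_induction (P := fun s => ‖f s‖ ≤ (2 * B + 3 * A) * √s) ?_ ?_ hs hs1
  · intro s hs hs1
    have := h0 s hs hs1
    have := le_sqrt_self (by linarith) hs1
    nlinarith
  · intro s hs hs1 ih
    have h2 := h1 s hs hs1
    have h3 : ‖2 * f (s / 2)‖ ≤ ‖f s‖ + ‖f s - 2 * f (s / 2)‖ := by
      have := norm_sub_le (f s) (f s - 2 * f (s / 2))
      rwa [sub_sub_cancel] at this
    rw [norm_mul, Complex.norm_ofNat] at h3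
    have h4 := le_sqrt_half hs.le
    have h5 := le_sqrt_self hs.le hs1
    have h6 : A * s ≤ A * √s := by gcongr
    have h7 := Real.sqrt_nonneg s
    have h8 : (2 * B + 3 * A) * (7 / 10 * √s) ≤ (2 * B + 3 * A) * √(s / 2) := by gcongr
    have h9 : 0 ≤ A * √s := by positivity
    have h10 : 0 ≤ B * √s := by positivity
    nlinarith

/-- Sums a geometric series over halvings: the ratio is at most 71/100, and 1 + 5 · 71/100 ≤ 5. -/
lemma norm_sub_le_of_half {F : ℝ → ℂ} {L : ℝ}
    (h : ∀ l, 1 / 2 ≤ l → l ≤ 1 → ∀ s, 0 < s → s ≤ 1 → ‖F s - F (l * s)‖ ≤ L * √s) {l s : ℝ}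
    (hl : 0 < l) (hl1 : l ≤ 1) (hs : 0 < s) (hs1 : s ≤ 1) : ‖F s - F (l * s)‖ ≤ 5 * L * √s := by
  have hL : 0 ≤ L := by
    have := (norm_nonneg _).trans (h 1 (by norm_num) le_rfl 1 one_pos le_rfl)
    simpa using this
  refine dyadic_induction (P := fun l => ∀ s, 0 < s → s ≤ 1 → ‖F s - F (l * s)‖ ≤ 5 * L * √s)
    ?_ ?_ hl hl1 s hs hs1
  · intro l hl hl1 s hs hs1
    have := h l hl hl1 s hs hs1
    have : 0 ≤ L * √s := by positivity
    linarith
  · intro l hl hl1 ih s hs hs1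
    have h1 := h (1 / 2) le_rfl (by norm_num) s hs hs1
    have h2 := ih (s / 2) (by linarith) (by linarith)
    have h3 := norm_sub_le_norm_sub_add_norm_sub (F s) (F (s / 2)) (F (l * (s / 2)))
    have h4 := sqrt_half_le hs.le
    rw [one_div_mul_eq_div] at h1
    rw [show l / 2 * s = l * (s / 2) by ring]
    have h5 : 5 * L * √(s / 2) ≤ 5 * L * (71 / 100 * √s) := by gcongr
    have h6 : 0 ≤ L * √s := by positivity
    nlinarith

/-- A function which is, on each dyadic scale, a quadratic polynomial up to an error of the order of
the scale has a limit at `0`. -/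
lemma exists_limit_of_near_quadratic {F : ℝ → ℂ} {B C : ℝ} (hC : 0 ≤ C)
    (h0 : ∀ s, 1 / 8 ≤ s → s ≤ 1 → ‖F s‖ ≤ B)
    (h1 : ∀ s, 0 < s → s ≤ 1 → ∃ α β γ : ℂ, ∀ s', s / 8 ≤ s' → s' ≤ s →
      ‖F s' - (α + β * s' + γ * s' ^ 2)‖ ≤ C * s') :
    ∃ y : ℂ, ∀ s, 0 < s → s ≤ 1 → ‖F s - y‖ ≤ 5 * (2 * (2 * B) + 3 * (2 * (6 * B) + 30 * C)) * √s := by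
  have hB : 0 ≤ B := (norm_nonneg _).trans (h0 1 (by norm_num) le_rfl)
  set L := 2 * (2 * B) + 3 * (2 * (6 * B) + 30 * C) with hL
  have hL0 : 0 ≤ L := by positivity
  -- The differences F(s) - F(ls), f(s) - 2f(s/2), g(s) - 4g(s/2) successively kill 1, s and s²;
  -- they are undone in reverse order. All six sample points lie in [s/8, s] because l ≥ 1/2. The
  -- coefficients 1, 6, 8, each on two sample points, give 30C, and g is bounded by 6B on [1/2, 1].
  have key : ∀ l, 1 / 2 ≤ l → l ≤ 1 → ∀ s, 0 < s → s ≤ 1 → ‖F s - F (l * s)‖ ≤ L * √s := by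
    intro l hl hl1 s hs hs1
    have hf0 : ∀ s, 1 / 4 ≤ s → s ≤ 1 → ‖F s - F (l * s)‖ ≤ 2 * B := by
      intro s hs hs1
      have e1 := h0 s (by linarith) hs1
      have e2 := h0 (l * s) (by nlinarith) (by nlinarith)
      have := norm_sub_le (F s) (F (l * s))
      linarith
    let f : ℝ → ℂ := fun s => F s - F (l * s)
    refine norm_le_of_two_mul (f := f) (by positivity) (fun s hs hs1 => hf0 s (by linarith) hs1) ?_
      hs hs1
    intro s hs hs1
    refine norm_le_of_four_mul (g := fun s => f s - 2 * f (s / 2)) (by positivity) ?_ ?_ hs hs1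
    · intro s hs hs1
      have e1 := hf0 s (by linarith) hs1
      have e2 := hf0 (s / 2) (by linarith) (by linarith)
      have e3 := norm_sub_le (f s) (2 * f (s / 2))
      rw [norm_mul, Complex.norm_ofNat] at e3
      simp only [f] at e3 ⊢
      linarith
    · intro s hs hs1
      obtain ⟨α, β, γ, h⟩ := h1 s hs hs1
      let p : ℝ → ℂ := fun s => α + β * s + γ * (s : ℂ) ^ 2
      have hb : ∀ s', s / 8 ≤ s' → s' ≤ s → ‖F s' - p s'‖ ≤ C * s := fun s' a b =>
        (h s' a b).trans (by gcongr)
      have e : f s - 2 * f (s / 2) - 4 * (f (s / 2) - 2 * f (s / 2 / 2)) =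
          (F s - p s) - (F (l * s) - p (l * s)) - 6 * ((F (s / 2) - p (s / 2)) -
            (F (l * (s / 2)) - p (l * (s / 2)))) + 8 * ((F (s / 2 / 2) - p (s / 2 / 2)) -
            (F (l * (s / 2 / 2)) - p (l * (s / 2 / 2)))) := by
        simp only [f, p]
        push_cast
        ring
      rw [e]
      have b1 := hb s (by linarith) le_rfl
      have b2 := hb (l * s) (by nlinarith) (by nlinarith)
      have b3 := hb (s / 2) (by linarith) (by linarith)
      have b4 := hb (l * (s / 2)) (by nlinarith) (by nlinarith)
      have b5 := hb (s / 2 / 2) (by linarith) (by linarith)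
      have b6 := hb (l * (s / 2 / 2)) (by nlinarith) (by nlinarith)
      have n1 := norm_sub_le (F s - p s) (F (l * s) - p (l * s))
      have n2 := norm_sub_le (F (s / 2) - p (s / 2)) (F (l * (s / 2)) - p (l * (s / 2)))
      have n3 := norm_sub_le (F (s / 2 / 2) - p (s / 2 / 2))
        (F (l * (s / 2 / 2)) - p (l * (s / 2 / 2)))
      refine (norm_add_le _ _).trans ?_
      refine (add_le_add_left (norm_sub_le _ _) _).trans ?_
      rw [norm_mul, norm_mul, Complex.norm_ofNat, Complex.norm_ofNat]
      linarith
  have hall : ∀ s, 0 < s → s ≤ 1 → ∀ s', 0 < s' → s' ≤ s → ‖F s - F s'‖ ≤ 5 * L * √s := by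
    intro s hs hs1 s' hs' hss'
    have := norm_sub_le_of_half key (div_pos hs' hs) ((div_le_one hs).2 hss') hs hs1
    rwa [div_mul_cancel₀ _ hs.ne'] at this
  let u : ℕ → ℝ := fun n => 1 / ((n : ℝ) + 1)
  have hu0 : ∀ n, 0 < u n := fun n => by positivity
  have hu : Tendsto u atTop (𝓝 0) := tendsto_one_div_add_atTop_nhds_zero_nat
  have hub : Tendsto (fun n => 2 * (5 * L * √(u n))) atTop (𝓝 0) := by
    have := ((Real.continuous_sqrt.tendsto 0).comp hu).const_mul (5 * L)
    have := this.const_mul 2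
    simpa using this
  have huanti : ∀ {m n : ℕ}, m ≤ n → u n ≤ u m := fun h => by
    simp only [u]; gcongr
  have hu1 : ∀ n, u n ≤ 1 := fun n => by
    have := huanti (Nat.zero_le n); simpa [u] using this
  have hcauchy : CauchySeq fun n => F (u n) := by
    refine cauchySeq_of_le_tendsto_0 _ (fun n m N hn hm => ?_) hub
    have e1 := hall (u N) (hu0 N) (hu1 N) (u n) (hu0 n) (huanti hn)
    have e2 := hall (u N) (hu0 N) (hu1 N) (u m) (hu0 m) (huanti hm)
    rw [dist_eq_norm]
    have := norm_sub_le (F (u N) - F (u m)) (F (u N) - F (u n))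
    rw [sub_sub_sub_cancel_left] at this
    linarith
  obtain ⟨y, hy⟩ := cauchySeq_tendsto_of_complete hcauchy
  refine ⟨y, fun s hs hs1 => ?_⟩
  refine le_of_tendsto (tendsto_const_nhds.sub hy).norm ?_
  filter_upwards [hu.eventually_le_const hs] with n hn
  exact hall s hs hs1 (u n) (hu0 n) hn

/-! ### Boundary values of potentials -/

/-- `Y` is the restriction to the circle of a continuous extension of `ψ`, with a rate of
convergence. -/
def HasBdry (ψ : 𝔻 → ℂ) (Y : ℂ → ℂ) : Prop :=
  ∃ K, ∀ w, ‖w‖ = 1 → ∀ s : ℝ, 0 < s → s ≤ 1 → ‖extend ψ ((1 - s : ℝ) * w) - Y w‖ ≤ K * √s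

lemma normSq_radial {w : ℂ} (hw : ‖w‖ = 1) (t : ℝ) : normSq ((t : ℂ) * w) = t ^ 2 := by
  rw [normSq_mul, normSq_ofReal, normSq_eq_norm_sq, hw]; ring

lemma norm_radial_lt {w : ℂ} (hw : ‖w‖ = 1) {s : ℝ} (hs : 0 < s) (hs1 : s ≤ 1) :
    ‖((1 - s : ℝ) : ℂ) * w‖ < 1 := by
  rw [norm_mul, hw, mul_one, norm_real, Real.norm_of_nonneg (by linarith)]
  linarith

section Cocompact

variable (Γ : Subgroup PSU11) [CompactSpace (Quotient (MulAction.orbitRel Γ 𝔻))]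

/-- The sum ψ + c_η is η^*ψ. Choose η moving (1 - s)w into the compact set of `exists_radius`. The
points (1 - s')w with s/8 ≤ s' ≤ s are at bounded hyperbolic distance, so η moves them into a larger
compact set, where ψ is bounded and |η'|⁻¹ ≤ 2s'/κ. -/
lemma exists_near_cocycle {c : Γ → 𝔻 → ℂ} {ψ : 𝔻 → ℂ} (hψ : IsSmooth ψ)
    (hc : ∀ γ : Γ, c γ = coboundary Γ ψ γ) :
    ∃ C, 0 ≤ C ∧ ∀ w, ‖w‖ = 1 → ∀ s : ℝ, 0 < s → s ≤ 1 → ∃ η : Γ, ∀ s' : ℝ, s / 8 ≤ s' → s' ≤ s →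
      ∀ u : 𝔻, (u : ℂ) = (1 - s' : ℝ) * w → ‖ψ u + c η u‖ ≤ C * s' := by
  obtain ⟨r, hr0, hr1, hr⟩ := exists_radius Γ
  -- The 32 is the distance constant J below: (2s)² = 32 · s · (s/8), where s and s/8 bound 1 - |z|²
  -- and 1 - |u|² from below.
  set κ := (1 - r) ^ 2 / 32 with hκ
  have hκ0 : 0 < κ := by
    have : 0 < 1 - r := by linarith
    positivity
  obtain ⟨M, hM0, hM⟩ := exists_bound_of_normSq_le hψ hκ0
  refine ⟨M * (2 / κ), by positivity, fun w hw s hs hs1 => ?_⟩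
  let z : 𝔻 := UnitDisc.mk _ (norm_radial_lt hw hs hs1)
  obtain ⟨η, hη⟩ := hr z
  refine ⟨η, fun s' hs' hs'1 u hu => ?_⟩
  have hz : (z : ℂ) = (1 - s : ℝ) * w := rfl
  have hs'0 : 0 < s' := by linarith
  have ez : 1 - normSq (z : ℂ) = 2 * s - s ^ 2 := by rw [hz, normSq_radial hw]; ring
  have eu : 1 - normSq (u : ℂ) = 2 * s' - s' ^ 2 := by rw [hu, normSq_radial hw]; ring
  have hww : conj w * w = 1 := by rw [mul_comm, mul_conj, normSq_eq_norm_sq, hw]; simp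
  have ezu : normSq (1 - conj (z : ℂ) * u) = (s + s' - s * s') ^ 2 := by
    have : 1 - conj (z : ℂ) * u = ((s + s' - s * s' : ℝ) : ℂ) := by
      rw [hz, hu, map_mul, conj_ofReal]
      push_cast
      linear_combination (-(1 - s) * (1 - s') : ℂ) * hww
    rw [this, normSq_ofReal, sq]
  have h1 := le_one_sub_normSq_smul (η : PSU11) z u (J := 32) hη hr1 (by
    rw [ez, eu, ezu]
    have a1 : s + s' - s * s' ≤ 2 * s := by nlinarith
    have a2 : 0 ≤ s + s' - s * s' := by nlinarith
    have a3 : s ≤ 2 * s - s ^ 2 := by nlinarith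
    have a5 : 0 ≤ 2 * s - s ^ 2 := by linarith
    have a4 : s / 8 ≤ 2 * s' - s' ^ 2 := by nlinarith
    calc (s + s' - s * s') ^ 2 ≤ (2 * s) ^ 2 := by gcongr
      _ = 32 * (s * (s / 8)) := by ring
      _ ≤ _ := by gcongr)
  have h2 : κ ≤ 1 - normSq ((η • u : 𝔻) : ℂ) := by
    have h1' : (1 - r) ^ 2 ≤ 32 * (1 - normSq ((η • u : 𝔻) : ℂ)) := h1
    rw [hκ]; linarith
  have h3 : ψ u + c η u = ψ (η • u) * (mobDeriv η u)⁻¹ := by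
    rw [hc η]; simp only [coboundary, pullback, add_sub_cancel]; rfl
  rw [h3, norm_mul, norm_inv_mobDeriv, eu, mul_assoc]
  have h4 : (2 * s' - s' ^ 2) / (1 - normSq ((η.1 • u : 𝔻) : ℂ)) ≤ 2 * s' / κ :=
    div_le_div₀ (by linarith) (by nlinarith) hκ0 h2
  have h5 := hM _ h2
  calc _ ≤ M * (2 * s' / κ) := mul_le_mul h5 h4 (by
        refine div_nonneg (by nlinarith) (hκ0.le.trans h2)) hM0
    _ = _ := by ring

/-- Invariant vector fields vanish on the circle. -/
lemma HasBdry.congr {c : Γ → 𝔻 → ℂ} {ψ φ : 𝔻 → ℂ} {Y : ℂ → ℂ} (hY : HasBdry ψ Y)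
    (hψ : IsSmooth ψ) (hφ : IsSmooth φ) (hc : ∀ γ : Γ, c γ = coboundary Γ ψ γ)
    (hc' : ∀ γ : Γ, c γ = coboundary Γ φ γ) : HasBdry φ Y := by
  obtain ⟨K, hK⟩ := hY
  have h0 : ∀ γ : Γ, (0 : 𝔻 → ℂ) = coboundary Γ (φ + (-1 : ℝ) • ψ) γ := by
    intro γ
    funext z
    have e := congrFun ((hc γ).symm.trans (hc' γ)) z
    simp only [coboundary, pullback, Pi.add_apply, Pi.smul_apply, Pi.zero_apply, real_smul] at e ⊢
    push_cast
    linear_combination e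
  obtain ⟨C, hC0, hC⟩ := exists_near_cocycle Γ (c := fun _ => 0) (hφ.add (hψ.const_smul (-1))) h0
  refine ⟨K + C, fun w hw s hs hs1 => ?_⟩
  obtain ⟨η, h⟩ := hC w hw s hs hs1
  have h1 := h s (by linarith) le_rfl (UnitDisc.mk _ (norm_radial_lt hw hs hs1)) rfl
  have h2 := hK w hw s hs hs1
  rw [extend_mk _ (norm_radial_lt hw hs hs1)] at h2 ⊢
  have h1 : ‖φ (UnitDisc.mk _ (norm_radial_lt hw hs hs1)) -
      ψ (UnitDisc.mk _ (norm_radial_lt hw hs hs1))‖ ≤ C * s := by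
    simpa [sub_eq_add_neg] using h1
  have h3 := norm_sub_le_norm_sub_add_norm_sub (φ (UnitDisc.mk _ (norm_radial_lt hw hs hs1)))
    (ψ (UnitDisc.mk _ (norm_radial_lt hw hs hs1))) (Y w)
  have h4 : C * s ≤ C * √s := mul_le_mul_of_nonneg_left (le_sqrt_self hs.le hs1) hC0
  linarith

/-- Restricted to a radius, -c_η is a quadratic polynomial in s, so the limit exists with constants
independent of w. Its radial part is α(2s - s²), without constant term; as ψ is O(s)-close to such
fields at every scale, the limit has no radial part. -/
theorem exists_hasBdry (c : Z1 Γ) {ψ : 𝔻 → ℂ} (hψ : IsSmooth ψ)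
    (hc : ∀ γ : Γ, (c.1 γ : 𝔻 → ℂ) = coboundary Γ ψ γ) :
    ∃ Y, HasBdry ψ Y ∧ ∀ w, ‖w‖ = 1 → (conj w * Y w).re = 0 := by
  obtain ⟨C, hC0, hC⟩ := exists_near_cocycle Γ (c := fun γ => c.1 γ) hψ hc
  -- For 1/8 ≤ s ≤ 1 one has 1 - (1 - s)² ≥ s ≥ 1/8.
  obtain ⟨B, hB0, hB⟩ := exists_bound_of_normSq_le hψ (κ := 1 / 8) (by norm_num)
  have hkill : ∀ w, ‖w‖ = 1 → ∀ s : ℝ, 0 < s → s ≤ 1 → ∃ a : ℂ, ∃ b : ℝ, ∀ s' : ℝ, s / 8 ≤ s' →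
      s' ≤ s → ‖extend ψ ((1 - s' : ℝ) * w) - (a + b * I * ((1 - s' : ℝ) * w) -
        conj a * ((1 - s' : ℝ) * w) ^ 2)‖ ≤ C * s' := by
    intro w hw s hs hs1
    obtain ⟨η, hη⟩ := hC w hw s hs hs1
    obtain ⟨a, b, hab⟩ := killing_eq (c.1 η).2
    refine ⟨-a, -b, fun s' hs' hs'1 => ?_⟩
    have hlt := norm_radial_lt hw (by linarith : 0 < s') (by linarith)
    have h := hη s' hs' hs'1 (UnitDisc.mk _ hlt) rfl
    rw [hab, UnitDisc.coe_mk] at h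
    rw [extend_mk _ hlt]
    refine le_trans (le_of_eq ?_) h
    congr 1
    rw [map_neg]
    push_cast
    ring
  have hlim : ∀ w : ℂ, ∃ y, ‖w‖ = 1 → ∀ s : ℝ, 0 < s → s ≤ 1 →
      ‖extend ψ ((1 - s : ℝ) * w) - y‖ ≤ 5 * (2 * (2 * B) + 3 * (2 * (6 * B) + 30 * C)) * √s := by
    intro w
    by_cases hw : ‖w‖ = 1
    · have h0 : ∀ s : ℝ, 1 / 8 ≤ s → s ≤ 1 → ‖extend ψ ((1 - s : ℝ) * w)‖ ≤ B := by
        intro s hs hs1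
        have hlt := norm_radial_lt hw (by linarith : 0 < s) hs1
        rw [extend_mk _ hlt]
        refine hB _ ?_
        rw [UnitDisc.coe_mk, normSq_radial hw]
        nlinarith
      obtain ⟨y, hy⟩ := exists_limit_of_near_quadratic
        (F := fun s : ℝ => extend ψ ((1 - s : ℝ) * w)) hC0 h0 fun s hs hs1 => by
          obtain ⟨a, b, hab⟩ := hkill w hw s hs hs1
          refine ⟨a + b * I * w - conj a * w ^ 2, -b * I * w + 2 * conj a * w ^ 2,
            - conj a * w ^ 2, fun s' hs' hs'1 => ?_⟩
          refine le_trans (le_of_eq ?_) (hab s' hs' hs'1)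
          congr 1
          push_cast
          ring
      exact ⟨y, fun _ => hy⟩
    · exact ⟨0, fun h => absurd h hw⟩
  choose Y hY using hlim
  set K := 5 * (2 * (2 * B) + 3 * (2 * (6 * B) + 30 * C)) with hK
  have hK0 : 0 ≤ K := by positivity
  refine ⟨Y, ⟨K, hY⟩, fun w hw => ?_⟩
  set y := (conj w * Y w).re with hy
  have hww : conj w * w = 1 := by rw [mul_comm, mul_conj, normSq_eq_norm_sq, hw]; simp
  let h : ℝ → ℝ := fun s => (conj w * extend ψ ((1 - s : ℝ) * w)).re
  have hre : ∀ v : ℂ, |(conj w * v).re| ≤ ‖v‖ := fun v => by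
    refine (abs_re_le_norm _).trans (le_of_eq ?_)
    rw [norm_mul, norm_conj, hw, one_mul]
  have e1 : ∀ s, 0 < s → s ≤ 1 → |h s - y| ≤ K * √s := by
    intro s hs hs1
    refine le_trans ?_ ((hre _).trans (hY w hw s hs hs1))
    rw [mul_sub, sub_re]
  have bound : ∀ s, 0 < s → s ≤ 1 → |y| ≤ (4 * K + |y| + 4 * C) * √s := by
    intro s hs hs1
    obtain ⟨a, b, hab⟩ := hkill w hw s hs hs1
    set α := (conj w * a).re with hα
    have e2 : ∀ s' : ℝ, s / 8 ≤ s' → s' ≤ s → |h s' - α * (2 * s' - s' ^ 2)| ≤ C * s' := by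
      intro s' hs' hs'1
      refine le_trans ?_ ((hre _).trans (hab s' hs' hs'1))
      have : (conj w * (a + b * I * ((1 - s' : ℝ) * w) - conj a * ((1 - s' : ℝ) * w) ^ 2)).re =
          α * (2 * s' - s' ^ 2) := by
        have e3 : conj w * (a + b * I * ((1 - s' : ℝ) * w) - conj a * ((1 - s' : ℝ) * w) ^ 2) =
            conj w * a + ((b * (1 - s') : ℝ) : ℂ) * I -
              (((1 - s') ^ 2 : ℝ) : ℂ) * conj (conj w * a) := by
          rw [map_mul, conj_conj]
          push_cast
          linear_combination (b * I * (1 - s') - conj a * (1 - s') ^ 2 * w) * hww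
        rw [e3, sub_re, add_re, re_ofReal_mul, re_ofReal_mul, I_re, conj_re, ← hα]
        ring
      rw [← this, mul_sub (conj w) (extend ψ _), sub_re]
    have f1 := e2 s (by linarith) le_rfl
    have f2 := e2 (s / 2) (by linarith) (by linarith)
    have f3 := e1 s hs hs1
    have f4 := e1 (s / 2) (by linarith) (by linarith)
    have q1 := le_sqrt_self hs.le hs1
    have q2 := sqrt_half_le hs.le
    have q3 : √s ≤ 1 := Real.sqrt_le_one.2 hs1
    -- The coefficient α depends on s and may grow as s → 0; boundedness of h near y only shows that
    -- α s stays bounded.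
    have hα1 : |α| * s ≤ K + |y| + C := by
      have g1 : |α * (2 * s - s ^ 2)| ≤ |h s - α * (2 * s - s ^ 2)| + |h s - y| + |y| := by
        have t1 := abs_sub_abs_le_abs_sub (α * (2 * s - s ^ 2)) (h s)
        have t2 := abs_sub_abs_le_abs_sub (h s) y
        rw [abs_sub_comm] at t1
        linarith
      rw [abs_mul, abs_of_nonneg (by nlinarith : 0 ≤ 2 * s - s ^ 2)] at g1
      have g2 : |α| * s ≤ |α| * (2 * s - s ^ 2) :=
        mul_le_mul_of_nonneg_left (by nlinarith) (abs_nonneg _)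
      have g3 : K * √s ≤ K := by nlinarith
      have g4 : C * s ≤ C := by nlinarith
      linarith
    have hα2 : |α * s ^ 2 / 2| ≤ (K + |y| + C) * s / 2 := by
      rw [abs_div, abs_mul, abs_of_nonneg (by positivity : 0 ≤ s ^ 2), abs_two]
      nlinarith
    have t' : |y| ≤ C * s + 2 * (C * (s / 2)) + K * √s + 2 * (K * √(s / 2)) +
        (K + |y| + C) * s / 2 := by
      -- The scales s and s/2 are combined to cancel the term 2αs. What remains of α is αs²/2, which
      -- is O(s) because αs is bounded.
      have t2 : -y = (h s - α * (2 * s - s ^ 2)) -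
        2 * (h (s / 2) - α * (2 * (s / 2) - (s / 2) ^ 2)) - (h s - y) + 2 * (h (s / 2) - y) -
        α * s ^ 2 / 2 := by ring
      rw [abs_le] at f1 f2 f3 f4 hα2
      rw [abs_le]
      constructor <;> linarith
    have r1 : C * s ≤ C * √s := by gcongr
    have r2 : (K + |y| + C) * s ≤ (K + |y| + C) * √s := by gcongr
    have r3 : K * √(s / 2) ≤ K * (71 / 100 * √s) := by gcongr
    have r4 : 0 ≤ K * √s := by positivity
    have r5 : 0 ≤ C * √s := by positivity
    have r6 : 0 ≤ |y| * √s := by positivity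
    nlinarith
  have ht : Tendsto (fun s => (4 * K + |y| + 4 * C) * √s) (𝓝[>] 0) (𝓝 0) := by
    have := (Real.continuous_sqrt.tendsto 0).const_mul (4 * K + |y| + 4 * C)
    rw [Real.sqrt_zero, mul_zero] at this
    exact this.mono_left nhdsWithin_le_nhds
  have : |y| ≤ 0 := ge_of_tendsto ht (by
    filter_upwards [Ioc_mem_nhdsGT (zero_lt_one' ℝ)] with s hs using bound s hs.1 hs.2)
  exact abs_eq_zero.1 (le_antisymm this (abs_nonneg y))

end Cocompact

/-! ### Change of variables on the circle -/

lemma exp_two_im (l : ℂ) : cexp ((2 * l.im : ℝ) * I) = cexp l / conj (cexp l) := by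
  rw [← exp_conj, ← Complex.exp_sub, sub_conj]

lemma norm_circleMap_one (t : ℝ) : ‖circleMap 0 1 t‖ = 1 := by simp

/-- A lift of the action of a Möbius transformation on the circle to the real line. -/
lemma exists_lift (A : SU11) : ∃ g g' : ℝ → ℝ, (∀ t, HasDerivAt g (g' t) t) ∧ Continuous g' ∧
    (∀ t, circleMap 0 1 (g t) = mob A (circleMap 0 1 t)) ∧ g (2 * Real.pi) = g 0 + 2 * Real.pi := by
  set a := A.1 0 0
  set b := A.1 0 1
  have hab : ‖b‖ < ‖a‖ := norm_b_lt_norm_a A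
  have ha : a ≠ 0 := norm_pos_iff.1 ((norm_nonneg _).trans_lt hab)
  set β := b / a with hβ
  have hβ1 : ‖β‖ < 1 := by rw [norm_div, div_lt_one (norm_pos_iff.2 ha)]; exact hab
  let e : ℝ → ℂ := fun t => circleMap 0 1 (-t)
  have he : ∀ t, conj (circleMap 0 1 t) = e t := fun t => by
    simp only [e, circleMap, zero_add, ofReal_one, one_mul, ← exp_conj, map_mul, conj_ofReal, conj_I,
      ofReal_neg]
    congr 1; ring
  have hec : Continuous e := (continuous_circleMap 0 1).comp continuous_neg
  have hed : ∀ t, HasDerivAt e (-(e t * I)) t := fun t => by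
    have := (hasDerivAt_circleMap 0 1 (-t)).scomp t (hasDerivAt_neg t)
    simpa [Function.comp_def] using this
  have hslit : ∀ t, 1 + β * e t ∈ slitPlane := fun t => by
    rw [mem_slitPlane_iff]
    left
    have h1 : ‖β * e t‖ < 1 := by
      rw [norm_mul, norm_circleMap_one, mul_one]; exact hβ1
    have h2 := (abs_re_le_norm (β * e t)).trans_lt h1
    rw [add_re, one_re]
    linarith [(abs_lt.1 h2).1]
  have hζ : ∀ t, 1 + β * e t ≠ 0 := fun t => slitPlane_ne_zero (hslit t)
  -- On the circle A(w) = w (a/ā)(ζ/ζ̄) with ζ = 1 + β w̄. As |β| < 1, ζ stays in the right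
  -- half-plane, so its principal argument is smooth and periodic and the lift gains exactly 2π.
  refine ⟨fun t => t + 2 * (log a).im + 2 * (log (1 + β * e t)).im,
    fun t => 1 + 2 * (β * -(e t * I) / (1 + β * e t)).im, ?_, ?_, ?_, ?_⟩
  · intro t
    have h1 := (((hed t).const_mul β).const_add 1).clog_real (hslit t)
    have h2 := (imCLM.hasFDerivAt.comp_hasDerivAt t h1).const_mul 2
    exact ((hasDerivAt_id t).add_const (2 * (log a).im)).add h2
  · have : Continuous fun t => β * -(e t * I) / (1 + β * e t) :=
      Continuous.div (by fun_prop) (by fun_prop) hζ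
    exact continuous_const.add (continuous_const.mul (continuous_im.comp this))
  · intro t
    have h1 : circleMap 0 1 (t + 2 * (log a).im + 2 * (log (1 + β * e t)).im) =
        circleMap 0 1 t * cexp ((2 * (log a).im : ℝ) * I) *
          cexp ((2 * (log (1 + β * e t)).im : ℝ) * I) := by
      simp only [circleMap, zero_add, ofReal_one, one_mul]
      rw [← Complex.exp_add, ← Complex.exp_add]
      congr 1
      push_cast
      ring
    have hw : circleMap 0 1 t * conj (circleMap 0 1 t) = 1 := by
      rw [mul_conj, normSq_eq_norm_sq, norm_circleMap_one]; simp
    rw [h1, exp_two_im, exp_two_im, exp_log ha, exp_log (hζ t), ← he]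
    have hd := den_ne_zero A (norm_circleMap_one t).le
    have hca : conj a ≠ 0 := (map_ne_zero _).2 ha
    have hcζ : conj (1 + β * conj (circleMap 0 1 t)) ≠ 0 := by
      rw [he]; exact (map_ne_zero _).2 (hζ t)
    have e1 : a * (1 + β * conj (circleMap 0 1 t)) = a + b * conj (circleMap 0 1 t) := by
      rw [hβ]; field_simp
    have e2 : conj a * conj (1 + β * conj (circleMap 0 1 t)) = den A (circleMap 0 1 t) := by
      rw [← map_mul, e1, den, SU11_c, SU11_d]; simp; ring
    rw [mob, mul_assoc, div_mul_div_comm, e1, e2, ← mul_div_assoc]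
    congr 1
    linear_combination b * hw
  · simp only [e]
    have : circleMap 0 1 (-(2 * Real.pi)) = circleMap 0 1 (-0) := by
      rw [(periodic_circleMap 0 1).neg_eq, neg_zero]
    rw [this]
    ring

/-- Averaging H(u)u over the circle is (1/2πi)∮ H(u) du, so this is substitution in a contour
integral, carried out on the lift from `exists_lift`. -/
lemma circleAverage_comp_mob (A : SU11) {H : ℂ → ℂ} (hH : ContinuousOn H (Metric.sphere 0 1)) :
    Real.circleAverage (fun w => H (mob A w) * ((den A w ^ 2)⁻¹ * w)) 0 1 =
      Real.circleAverage (fun u => H u * u) 0 1 := by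
  obtain ⟨g, g', hg, hg', hgm, hper⟩ := exists_lift A
  have hmem : ∀ t : ℝ, circleMap 0 1 t ∈ Metric.sphere (0 : ℂ) 1 := fun t =>
    mem_sphere_zero_iff_norm.2 (norm_circleMap_one t)
  let h : ℝ → ℂ := fun t => H (circleMap 0 1 t) * circleMap 0 1 t
  have hcont : Continuous h :=
    (hH.comp_continuous (continuous_circleMap 0 1) hmem).mul (continuous_circleMap 0 1)
  have hp : Function.Periodic h (2 * Real.pi) := fun t => by
    simp only [h, (periodic_circleMap 0 1) t]
  have e1 : ∀ t, g' t • (h ∘ g) t = H (mob A (circleMap 0 1 t)) *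
      ((den A (circleMap 0 1 t) ^ 2)⁻¹ * circleMap 0 1 t) := by
    intro t
    have d1 := (hasDerivAt_circleMap 0 1 (g t)).scomp t (hg t)
    have d2 := (hasDerivAt_mob A (norm_circleMap_one t).le).scomp t (hasDerivAt_circleMap 0 1 t)
    have e : circleMap 0 1 ∘ g = mob A ∘ circleMap 0 1 := funext hgm
    rw [e] at d1
    have d3 := d1.unique d2
    simp only [h, Function.comp_apply, real_smul, hgm, smul_eq_mul] at d3 ⊢
    linear_combination H (mob A (circleMap 0 1 t)) * (-I) * d3 + (g' t * mob A (circleMap 0 1 t) -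
      (den A (circleMap 0 1 t) ^ 2)⁻¹ * circleMap 0 1 t) * H (mob A (circleMap 0 1 t)) * I_mul_I
  simp only [Real.circleAverage]
  congr 1
  simp only [← e1]
  rw [intervalIntegral.integral_deriv_smul_comp (fun t _ => hg t) hg'.continuousOn hcont, hper,
    hp.intervalIntegral_add_eq (g 0) 0, zero_add]

/-! ### Continuity up to the circle -/

section Boundary

variable {ψ : 𝔻 → ℂ} {Y : ℂ → ℂ}

lemma HasBdry.tendstoUniformlyOn (h : HasBdry ψ Y) :
    TendstoUniformlyOn (fun (s : ℝ) w => extend ψ ((1 - s : ℝ) * w)) Y (𝓝[>] 0)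
      (Metric.sphere 0 1) := by
  obtain ⟨K, hK⟩ := h
  have ht : Tendsto (fun s => K * √s) (𝓝[>] 0) (𝓝 0) := by
    have := (Real.continuous_sqrt.tendsto 0).const_mul K
    rw [Real.sqrt_zero, mul_zero] at this
    exact this.mono_left nhdsWithin_le_nhds
  rw [Metric.tendstoUniformlyOn_iff]
  intro ε hε
  filter_upwards [Ioc_mem_nhdsGT (zero_lt_one' ℝ), ht.eventually_lt_const hε] with s hs hs' w hw
  rw [dist_comm, dist_eq_norm]
  exact (hK w (mem_sphere_zero_iff_norm.1 hw) s hs.1 hs.2).trans_lt hs'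

lemma HasBdry.continuousOn (h : HasBdry ψ Y) (hψ : IsSmooth ψ) :
    ContinuousOn Y (Metric.sphere 0 1) := by
  refine h.tendstoUniformlyOn.continuousOn (Eventually.frequently ?_)
  filter_upwards [Ioc_mem_nhdsGT (zero_lt_one' ℝ)] with s hs
  refine (show ContDiffOn ℝ ∞ (extend ψ) _ from hψ).continuousOn.comp (by fun_prop) fun w hw => ?_
  exact mem_ball_zero_iff.2 (norm_radial_lt (mem_sphere_zero_iff_norm.1 hw) hs.1 hs.2)

/-- Möbius maps do not preserve radii, so radial limits are not enough. The uniform rate and the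
continuity of Y on the circle upgrade them to unrestricted limits. -/
lemma HasBdry.tendsto (h : HasBdry ψ Y) (hψ : IsSmooth ψ) {v : ℂ} (hv : ‖v‖ = 1) :
    Tendsto (extend ψ) (𝓝[Metric.ball 0 1] v) (𝓝 (Y v)) := by
  have hY := h.continuousOn hψ
  obtain ⟨K, hK⟩ := h
  have hv0 : v ≠ 0 := norm_pos_iff.1 (by rw [hv]; exact one_pos)
  have h1 : Tendsto (fun z : ℂ => z / ‖z‖) (𝓝[Metric.ball 0 1] v) (𝓝[Metric.sphere 0 1] v) := by
    refine tendsto_nhdsWithin_iff.2 ⟨?_, ?_⟩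
    · have : ContinuousAt (fun z : ℂ => z / ‖z‖) v := by
        refine continuousAt_id.div (by fun_prop) ?_
        rw [hv]; simp
      have := this.tendsto
      rw [hv, ofReal_one, div_one] at this
      exact this.mono_left nhdsWithin_le_nhds
    · filter_upwards [mem_nhdsWithin_of_mem_nhds (isOpen_ne.mem_nhds hv0)] with z hz
      have : ‖z‖ ≠ 0 := norm_ne_zero_iff.2 hz
      rw [mem_sphere_zero_iff_norm, norm_div, norm_real, norm_norm, div_self this]
  have h2 := (hY v (mem_sphere_zero_iff_norm.2 hv)).tendsto.comp h1
  have h3 : Tendsto (fun z : ℂ => K * √(1 - ‖z‖)) (𝓝[Metric.ball 0 1] v) (𝓝 0) := by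
    have hc : Continuous fun z : ℂ => K * √(1 - ‖z‖) := by fun_prop
    have := hc.tendsto v
    simp only [hv, sub_self, Real.sqrt_zero, mul_zero] at this
    exact this.mono_left nhdsWithin_le_nhds
  have h4 : Tendsto (fun z => extend ψ z - Y (z / ‖z‖)) (𝓝[Metric.ball 0 1] v) (𝓝 0) := by
    refine squeeze_zero_norm' ?_ h3
    filter_upwards [self_mem_nhdsWithin, mem_nhdsWithin_of_mem_nhds (isOpen_ne.mem_nhds hv0)]
      with z hz hz0
    have hn : ‖z‖ ≠ 0 := norm_ne_zero_iff.2 hz0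
    have hw : ‖z / ‖z‖‖ = 1 := by rw [norm_div, norm_real, norm_norm, div_self hn]
    have hz1 := mem_ball_zero_iff.1 hz
    have := hK (z / ‖z‖) hw (1 - ‖z‖) (by linarith) (by linarith [norm_nonneg z])
    rwa [sub_sub_cancel, mul_div_cancel₀ _ (ofReal_ne_zero.2 hn)] at this
  simpa using h4.add h2

lemma HasBdry.eq_of_continuous (h : HasBdry ψ Y) (hψ : IsSmooth ψ) {F : ℂ → ℂ} (hF : Continuous F)
    (hψF : ∀ z : 𝔻, ψ z = F z) {v : ℂ} (hv : ‖v‖ = 1) : Y v = F v := by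
  have : (𝓝[Metric.ball (0 : ℂ) 1] v).NeBot := by
    rw [← mem_closure_iff_nhdsWithin_neBot, closure_ball _ one_ne_zero]
    exact mem_closedBall_zero_iff.2 hv.le
  refine tendsto_nhds_unique (h.tendsto hψ hv) ?_
  refine ((hF.tendsto v).mono_left nhdsWithin_le_nhds).congr' ?_
  filter_upwards [self_mem_nhdsWithin] with z hz
  exact (eqOn_extend hψF hz).symm

lemma norm_mob_sphere (A : SU11) {w : ℂ} (hw : ‖w‖ = 1) : ‖mob A w‖ = 1 := by
  have h := one_sub_normSq_mob A hw.le
  rw [normSq_eq_norm_sq w, hw, one_pow, sub_self, zero_div, normSq_eq_norm_sq, sub_eq_zero] at h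
  exact (pow_eq_one_iff_of_nonneg (norm_nonneg _) two_ne_zero).1 h.symm

/-- The limit at the circle of ψ(γz) = γ'(z)(ψ(z) + c_γ(z)). -/
lemma HasBdry.comp_mob (h : HasBdry ψ Y) (hψ : IsSmooth ψ) (A : SU11) {F : ℂ → ℂ}
    (hF : Continuous F)
    (hc : ∀ z : 𝔻, F z = pullback (QuotientGroup.mk A) ψ z - ψ z) {w : ℂ} (hw : ‖w‖ = 1) :
    Y (mob A w) = (den A w ^ 2)⁻¹ * (Y w + F w) := by
  have hne : (𝓝[Metric.ball (0 : ℂ) 1] w).NeBot := by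
    rw [← mem_closure_iff_nhdsWithin_neBot, closure_ball _ one_ne_zero]
    exact mem_closedBall_zero_iff.2 hw.le
  have hmob : Tendsto (mob A) (𝓝[Metric.ball 0 1] w) (𝓝[Metric.ball 0 1] (mob A w)) := by
    refine tendsto_nhdsWithin_iff.2 ⟨?_, ?_⟩
    · exact (hasDerivAt_mob A hw.le).continuousAt.tendsto.mono_left nhdsWithin_le_nhds
    · filter_upwards [self_mem_nhdsWithin] with z hz
      rw [← UnitDisc.coe_mk z (mem_ball_zero_iff.1 hz), ← coe_smul_eq_mob]
      exact mem_ball_coe _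
  have h1 := (h.tendsto hψ (norm_mob_sphere A hw)).comp hmob
  have hden : Tendsto (fun z => (den A z ^ 2)⁻¹) (𝓝[Metric.ball 0 1] w) (𝓝 ((den A w ^ 2)⁻¹)) := by
    have hd : Continuous (den A) := by unfold den; fun_prop
    exact (((hd.pow 2).tendsto w).inv₀ (pow_ne_zero 2 (den_ne_zero A hw.le))).mono_left
      nhdsWithin_le_nhds
  have h2 := hden.mul ((h.tendsto hψ hw).add ((hF.tendsto w).mono_left nhdsWithin_le_nhds))
  refine tendsto_nhds_unique h1 (h2.congr' ?_)
  filter_upwards [self_mem_nhdsWithin] with z hz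
  have hz1 := mem_ball_zero_iff.1 hz
  have e := hc (UnitDisc.mk z hz1)
  have e1 : extend ψ (mob A z) = ψ ((QuotientGroup.mk A : PSU11) • UnitDisc.mk z hz1) := by
    rw [← extend_coe ψ, coe_smul_eq_mob, UnitDisc.coe_mk]
  have hd := den_ne_zero A hz1.le
  rw [pullback, mobDeriv_mk, inv_inv, UnitDisc.coe_mk] at e
  rw [Function.comp_apply, e1, extend_mk _ hz1, e]
  field_simp
  ring

/-! ### `L²` boundary values -/

lemma exists_CircleL2 (hY : ContinuousOn Y (Metric.sphere 0 1)) :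
    ∃ X : CircleL2, ∀ᵐ θ ∂arc, X θ = Y (pt θ) := by
  have hc : Continuous fun θ => Y (pt θ) :=
    hY.comp_continuous continuous_pt fun θ => mem_sphere_zero_iff_norm.2 (norm_pt θ)
  have hm : MemLp (fun θ => Y (pt θ)) 2 arc :=
    hc.memLp_of_hasCompactSupport (HasCompactSupport.of_compactSpace _)
  exact ⟨hm.toLp _, hm.coeFn_toLp⟩

lemma HasBdry.isL2Boundary (h : HasBdry ψ Y) {X : CircleL2} (hX : ∀ᵐ θ ∂arc, X θ = Y (pt θ)) :
    IsL2Boundary ψ X := by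
  obtain ⟨K, hK⟩ := h
  have ht : Tendsto (fun r : ℝ => ENNReal.ofReal (K * √(1 - r))) (𝓝[<] 1) (𝓝 0) := by
    have hc : Continuous fun r : ℝ => K * √(1 - r) := by fun_prop
    have := (ENNReal.tendsto_ofReal (hc.tendsto 1)).mono_left
      (nhdsWithin_le_nhds (s := Iio (1 : ℝ)))
    simpa using this
  refine tendsto_of_tendsto_of_tendsto_of_le_of_le' tendsto_const_nhds ht
    (Eventually.of_forall fun _ => zero_le) ?_
  filter_upwards [Ico_mem_nhdsLT (zero_lt_one' ℝ)] with r hr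
  refine (eLpNorm_le_of_ae_bound (C := K * √(1 - r)) ?_).trans (le_of_eq (by simp))
  filter_upwards [hX] with θ hθ
  have := hK (pt θ) (norm_pt θ) (1 - r) (by linarith [hr.2]) (by linarith [hr.1])
  rwa [sub_sub_cancel, ← hθ] at this

lemma IsL2Boundary.unique (hψ : IsSmooth ψ) {X X' : CircleL2} (h : IsL2Boundary ψ X)
    (h' : IsL2Boundary ψ X') : X = X' := by
  have ht : Tendsto (fun r : ℝ => eLpNorm (fun θ => extend ψ (r * pt θ) - X' θ) 2 arc +
      eLpNorm (fun θ => extend ψ (r * pt θ) - X θ) 2 arc) (𝓝[<] 1) (𝓝 0) := by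
    simpa using Tendsto.add h' h
  have hle : ∀ᶠ r : ℝ in 𝓝[<] 1, eLpNorm (fun θ => X θ - X' θ) 2 arc ≤
      eLpNorm (fun θ => extend ψ (r * pt θ) - X' θ) 2 arc +
      eLpNorm (fun θ => extend ψ (r * pt θ) - X θ) 2 arc := by
    filter_upwards [Ico_mem_nhdsLT (zero_lt_one' ℝ)] with r hr
    have hc : Continuous fun θ => extend ψ (r * pt θ) := by
      refine (show ContDiffOn ℝ ∞ (extend ψ) _ from hψ).continuousOn.comp_continuous (by fun_prop)
        fun θ => ?_
      rw [mem_ball_zero_iff, norm_mul, norm_pt, mul_one, norm_real, Real.norm_of_nonneg hr.1]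
      exact hr.2
    have := eLpNorm_sub_le (μ := arc) (p := 2)
      (hc.aestronglyMeasurable.sub (Lp.aestronglyMeasurable X'))
      (hc.aestronglyMeasurable.sub (Lp.aestronglyMeasurable X)) one_le_two
    refine le_trans (le_of_eq ?_) this
    congr 1
    funext θ
    simp
  have h0 : eLpNorm (fun θ => X θ - X' θ) 2 arc ≤ 0 := ge_of_tendsto ht hle
  have h1 : eLpNorm (X - X' : CircleL2) 2 arc = 0 := by
    rw [← le_zero_iff]
    refine le_trans (le_of_eq (eLpNorm_congr_ae ?_)) h0
    exact Lp.coeFn_sub X X'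
  rw [← sub_eq_zero, ← norm_eq_zero, Lp.norm_def, h1]
  rfl

lemma HasBdry.ae_eq (h : HasBdry ψ Y) (hψ : IsSmooth ψ) {X : CircleL2} (hX : IsL2Boundary ψ X) :
    ∀ᵐ θ ∂arc, X θ = Y (pt θ) := by
  obtain ⟨X', hX'⟩ := exists_CircleL2 (h.continuousOn hψ)
  rwa [IsL2Boundary.unique hψ hX (h.isL2Boundary hX')]

lemma conj_eq_of_tangential {v w : ℂ} (hw : ‖w‖ = 1) (h : (conj w * v).re = 0) :
    conj v = - v * conj w ^ 2 := by
  have hww : w * conj w = 1 := by rw [mul_conj, normSq_eq_norm_sq, hw]; simp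
  have h1 := add_conj (conj w * v)
  rw [h, map_mul, conj_conj] at h1
  simp only [mul_zero, ofReal_zero] at h1
  linear_combination conj w * h1 - conj v * hww

lemma isTangential_of_ae_eq {X : CircleL2} (hX : ∀ᵐ θ ∂arc, X θ = Y (pt θ))
    (hY : ∀ w, ‖w‖ = 1 → (conj w * Y w).re = 0) : IsTangential X := by
  filter_upwards [hX] with θ hθ
  refine ⟨(conj (pt θ) * Y (pt θ)).im, ?_⟩
  have h := hY _ (norm_pt θ)
  have h1 : conj (pt θ) * Y (pt θ) = ((conj (pt θ) * Y (pt θ)).im : ℂ) * I := by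
    conv_lhs => rw [← re_add_im (conj (pt θ) * Y (pt θ)), h, ofReal_zero, zero_add]
  rw [hθ]
  linear_combination pt θ * h1 - Y (pt θ) * pt_mul_conj θ

/-! ### Invariance of the quadratic differential -/

/-- On the circle w̄ = 1/w. The right side is (1/2πi)∮ F(w)(w - z)⁻⁴ dw, the form suited to Möbius
substitution. -/
lemma circleAverage_cauchy_eq {F : ℂ → ℂ} {z : ℂ} (hz : ‖z‖ < 1) :
    Real.circleAverage (fun w => F w * conj w ^ 3 * (1 - conj w * z)⁻¹ ^ 4) 0 1 =
      Real.circleAverage (fun w => F w / (w - z) ^ 4 * w) 0 1 := by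
  refine Real.circleAverage_congr_sphere fun w hw => ?_
  rw [abs_one, mem_sphere_zero_iff_norm] at hw
  have hww : w * conj w = 1 := by rw [mul_conj, normSq_eq_norm_sq, hw]; simp
  have hw0 : w ≠ 0 := norm_pos_iff.1 (by rw [hw]; exact one_pos)
  have hcw : conj w = w⁻¹ := eq_inv_of_mul_eq_one_right hww
  have hwz : w - z ≠ 0 := by
    intro h
    rw [← sub_eq_zero.1 h, hw] at hz
    exact lt_irrefl _ hz
  have e : 1 - w⁻¹ * z = (w - z) * w⁻¹ := by field_simp
  simp only [hcw]
  rw [e]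
  field_simp

/-- Substitute w ↦ A(w) in the contour integral. The field and dw each contribute den(w)⁻², and
(A(w) - A(z))⁻⁴ contributes den(w)⁴ den(z)⁴, so the powers of den(w) cancel and den(z)⁴ remains. The
quadratic correction integrates to zero by `circleAverage_quadratic`. -/
lemma conjCauchy_mob {Z : AddCircle (2 * Real.pi) → ℂ} (hZ : ∀ᵐ θ ∂arc, Z θ = Y (pt θ))
    (hY : ContinuousOn Y (Metric.sphere 0 1)) (hYt : ∀ w, ‖w‖ = 1 → (conj w * Y w).re = 0)
    (A : SU11) {a b c : ℂ}
    (hA : ∀ w, ‖w‖ = 1 → Y (mob A w) = (den A w ^ 2)⁻¹ * (Y w + (a + b * w + c * w ^ 2))) (z : 𝔻) :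
    conjCauchy Z 4 (mob A z) * (den A z ^ 2)⁻¹ ^ 2 = conjCauchy Z 4 z := by
  have hz := z.norm_lt_one
  have hmz : ‖mob A z‖ < 1 := by rw [← coe_smul_eq_mob]; exact UnitDisc.norm_lt_one _
  have ht : ∀ w, ‖w‖ = 1 → conj (Y w) = - Y w * conj w ^ 2 := fun w hw =>
    conj_eq_of_tangential hw (hYt w hw)
  have hne : ∀ {v : ℂ}, ‖v‖ < 1 → ∀ w, ‖w‖ = 1 → w - v ≠ 0 := by
    intro v hv w hw h
    rw [← sub_eq_zero.1 h, hw] at hv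
    exact lt_irrefl _ hv
  have hcont : ∀ {F : ℂ → ℂ}, ContinuousOn F (Metric.sphere 0 1) → ∀ {v : ℂ}, ‖v‖ < 1 →
      ContinuousOn (fun w => F w / (w - v) ^ 4) (Metric.sphere 0 1) := by
    intro F hF v hv
    refine hF.div (by fun_prop) fun w hw => pow_ne_zero 4 (hne hv w (mem_sphere_zero_iff_norm.1 hw))
  have hint : ∀ {F : ℂ → ℂ}, ContinuousOn F (Metric.sphere 0 1) →
      CircleIntegrable (fun w => den A z ^ 4 * (F w / (w - z) ^ 4 * w)) 0 1 := fun hF =>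
    (continuousOn_const.mul ((hcont hF hz).mul continuousOn_id)).circleIntegrable zero_le_one
  rw [conjCauchy_of_tangential hZ ht, conjCauchy_of_tangential hZ ht, circleAverage_cauchy_eq hmz,
    circleAverage_cauchy_eq hz, ← circleAverage_comp_mob A (hcont hY hmz)]
  have hdz := den_ne_zero A hz.le
  have e1 : Real.circleAverage (fun w => Y (mob A w) / (mob A w - mob A z) ^ 4 *
      ((den A w ^ 2)⁻¹ * w)) 0 1 = Real.circleAverage (fun w =>
        den A z ^ 4 * (Y w / (w - z) ^ 4 * w) +
        den A z ^ 4 * ((a + b * w + c * w ^ 2) / (w - z) ^ 4 * w)) 0 1 := by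
    refine Real.circleAverage_congr_sphere fun w hw => ?_
    rw [abs_one, mem_sphere_zero_iff_norm] at hw
    have hdw := den_ne_zero A hw.le
    have hwz := hne hz w hw
    simp only [hA w hw, mob_sub_mob A hw.le hz.le]
    field_simp
  have e2 := circleAverage_quadratic a b c hz
  rw [circleAverage_cauchy_eq (F := fun w => a + b * w + c * w ^ 2) hz] at e2
  have e3 : ∀ f : ℂ → ℂ, Real.circleAverage (fun w => den A z ^ 4 * f w) 0 1 =
      den A z ^ 4 * Real.circleAverage f 0 1 := fun f =>
    Real.circleAverage_fun_smul (a := den A z ^ 4) (f := f)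
  rw [e1, Real.circleAverage_fun_add (hint hY) (hint (by fun_prop)), e3, e3, e2]
  field_simp
  ring

end Boundary

/-! ### The map from cohomology to quadratic differentials -/

lemma HasBdry.add {ψ φ : 𝔻 → ℂ} {Y Z : ℂ → ℂ} (h : HasBdry ψ Y) (h' : HasBdry φ Z) :
    HasBdry (ψ + φ) (Y + Z) := by
  obtain ⟨K, hK⟩ := h
  obtain ⟨L, hL⟩ := h'
  refine ⟨K + L, fun w hw s hs hs1 => ?_⟩
  rw [extend_add, Pi.add_apply, Pi.add_apply, add_sub_add_comm, add_mul]
  exact (norm_add_le _ _).trans (add_le_add (hK w hw s hs hs1) (hL w hw s hs hs1))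

lemma HasBdry.const_smul {ψ : 𝔻 → ℂ} {Y : ℂ → ℂ} (h : HasBdry ψ Y) (r : ℝ) :
    HasBdry (r • ψ) (r • Y) := by
  obtain ⟨K, hK⟩ := h
  refine ⟨|r| * K, fun w hw s hs hs1 => ?_⟩
  rw [extend_const_smul, Pi.smul_apply, Pi.smul_apply, ← smul_sub, norm_smul, Real.norm_eq_abs,
    mul_assoc]
  exact mul_le_mul_of_nonneg_left (hK w hw s hs hs1) (abs_nonneg r)

lemma conjCauchy_congr {Y Z : AddCircle (2 * Real.pi) → ℂ} (h : ∀ᵐ θ ∂arc, Y θ = Z θ) (k : ℕ)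
    (z : ℂ) : conjCauchy Y k z = conjCauchy Z k z := by
  refine integral_congr_ae ?_
  filter_upwards [h] with θ hθ
  rw [hθ]

lemma conjCauchy_add {Y Z : AddCircle (2 * Real.pi) → ℂ} (hY : Integrable Y arc)
    (hZ : Integrable Z arc) (k : ℕ) {z : ℂ} (hz : ‖z‖ < 1) :
    conjCauchy (fun θ => Y θ + Z θ) k z = conjCauchy Y k z + conjCauchy Z k z := by
  simp only [conjCauchy, cauchyInt]
  rw [← integral_add (integrable_cauchy (integrable_mul_conj (integrable_conj hY)) hz k)
    (integrable_cauchy (integrable_mul_conj (integrable_conj hZ)) hz k)]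
  refine integral_congr_ae (Eventually.of_forall fun θ => ?_)
  simp only [map_add]
  ring

lemma conjCauchy_smul (r : ℝ) (Y : AddCircle (2 * Real.pi) → ℂ) (k : ℕ) (z : ℂ) :
    conjCauchy (fun θ => r * Y θ) k z = r * conjCauchy Y k z := by
  simp only [conjCauchy, cauchyInt]
  rw [← integral_const_mul]
  refine integral_congr_ae (Eventually.of_forall fun θ => ?_)
  simp only [map_mul, conj_ofReal]
  ring

lemma coboundary_add (Γ : Subgroup PSU11) (ψ φ : 𝔻 → ℂ) (γ : Γ) :
    coboundary Γ (ψ + φ) γ = coboundary Γ ψ γ + coboundary Γ φ γ := by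
  funext z
  simp only [coboundary, pullback, Pi.add_apply]
  ring

lemma coboundary_smul (Γ : Subgroup PSU11) (r : ℝ) (ψ : 𝔻 → ℂ) (γ : Γ) :
    coboundary Γ (r • ψ) γ = r • coboundary Γ ψ γ := by
  funext z
  simp only [coboundary, pullback, Pi.smul_apply, real_smul]
  ring

section

variable (Γ : Subgroup PSU11) [DiscreteTopology Γ] [CompactSpace (Quotient (MulAction.orbitRel Γ 𝔻))]

/-- The boundary values of the potentials of a cocycle. -/
lemma exists_bdry (c : Z1 Γ) : ∃ Y : ℂ → ℂ, ContinuousOn Y (Metric.sphere 0 1) ∧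
    (∀ w, ‖w‖ = 1 → (conj w * Y w).re = 0) ∧ ∀ ψ : 𝔻 → ℂ, IsSmooth ψ →
      (∀ γ : Γ, (c.1 γ : 𝔻 → ℂ) = coboundary Γ ψ γ) → HasBdry ψ Y := by
  obtain ⟨ψ, hψ, hc⟩ := exists_potential Γ c
  obtain ⟨Y, hY, hYt⟩ := exists_hasBdry Γ c hψ hc
  exact ⟨Y, hY.continuousOn hψ, hYt, fun φ hφ hc' => hY.congr Γ hψ hφ hc hc'⟩

/-- The common boundary values of the potentials of a cocycle. -/
def bdry (c : Z1 Γ) : ℂ → ℂ := (exists_bdry Γ c).choose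

lemma continuousOn_bdry (c : Z1 Γ) : ContinuousOn (bdry Γ c) (Metric.sphere 0 1) :=
  (exists_bdry Γ c).choose_spec.1

lemma tangential_bdry (c : Z1 Γ) : ∀ w, ‖w‖ = 1 → (conj w * bdry Γ c w).re = 0 :=
  (exists_bdry Γ c).choose_spec.2.1

lemma hasBdry_bdry (c : Z1 Γ) {ψ : 𝔻 → ℂ} (hψ : IsSmooth ψ)
    (hc : ∀ γ : Γ, (c.1 γ : 𝔻 → ℂ) = coboundary Γ ψ γ) : HasBdry ψ (bdry Γ c) :=
  (exists_bdry Γ c).choose_spec.2.2 ψ hψ hc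

/-- The boundary values of a cocycle, as a square integrable vector field. -/
def bdryL2 (c : Z1 Γ) : CircleL2 := (exists_CircleL2 (continuousOn_bdry Γ c)).choose

lemma bdryL2_ae_eq (c : Z1 Γ) : ∀ᵐ θ ∂arc, bdryL2 Γ c θ = bdry Γ c (pt θ) :=
  (exists_CircleL2 (continuousOn_bdry Γ c)).choose_spec

lemma isL2Boundary_bdryL2 (c : Z1 Γ) {ψ : 𝔻 → ℂ} (hψ : IsSmooth ψ)
    (hc : ∀ γ : Γ, (c.1 γ : 𝔻 → ℂ) = coboundary Γ ψ γ) : IsL2Boundary ψ (bdryL2 Γ c) :=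
  (hasBdry_bdry Γ c hψ hc).isL2Boundary (bdryL2_ae_eq Γ c)

lemma eq_bdryL2 (c : Z1 Γ) {ψ : 𝔻 → ℂ} (hψ : IsSmooth ψ)
    (hc : ∀ γ : Γ, (c.1 γ : 𝔻 → ℂ) = coboundary Γ ψ γ) {X : CircleL2} (hX : IsL2Boundary ψ X) :
    X = bdryL2 Γ c :=
  IsL2Boundary.unique hψ hX (isL2Boundary_bdryL2 Γ c hψ hc)

/-- Boundary fields are obtained by choice, so additivity has to come from uniqueness: the sum of
two potentials is a potential of the sum. -/
lemma bdryL2_add_ae_eq (c d : Z1 Γ) :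
    ∀ᵐ θ ∂arc, bdryL2 Γ (c + d) θ = bdryL2 Γ c θ + bdryL2 Γ d θ := by
  obtain ⟨ψ, hψ, hc⟩ := exists_potential Γ c
  obtain ⟨φ, hφ, hd⟩ := exists_potential Γ d
  have h : ∀ γ : Γ, ((c + d).1 γ : 𝔻 → ℂ) = coboundary Γ (ψ + φ) γ := fun γ => by
    rw [coboundary_add, ← hc, ← hd]; rfl
  have h1 := ((hasBdry_bdry Γ c hψ hc).add (hasBdry_bdry Γ d hφ hd)).ae_eq (hψ.add hφ)
    (isL2Boundary_bdryL2 Γ (c + d) (hψ.add hφ) h)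
  filter_upwards [h1, bdryL2_ae_eq Γ c, bdryL2_ae_eq Γ d] with θ e1 e2 e3
  rw [e1, e2, e3, Pi.add_apply]

lemma bdryL2_smul_ae_eq (r : ℝ) (c : Z1 Γ) :
    ∀ᵐ θ ∂arc, bdryL2 Γ (r • c) θ = r * bdryL2 Γ c θ := by
  obtain ⟨ψ, hψ, hc⟩ := exists_potential Γ c
  have h : ∀ γ : Γ, ((r • c).1 γ : 𝔻 → ℂ) = coboundary Γ (r • ψ) γ := fun γ => by
    rw [coboundary_smul, ← hc]; rfl
  have h1 := ((hasBdry_bdry Γ c hψ hc).const_smul r).ae_eq (hψ.const_smul r)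
    (isL2Boundary_bdryL2 Γ (r • c) (hψ.const_smul r) h)
  filter_upwards [h1, bdryL2_ae_eq Γ c] with θ e1 e2
  rw [e1, e2, Pi.smul_apply, real_smul]

lemma quadDiff_mem_HQD (c : Z1 Γ) : quadDiff (poissonMap (bdryL2 Γ c)) ∈ HQD Γ := by
  refine ⟨differentiableOn_quadDiff_poissonMap _, ?_⟩
  rintro ⟨γ, hγ⟩ z
  obtain ⟨A, rfl⟩ := QuotientGroup.mk_surjective γ
  obtain ⟨ψ, hψ, hc⟩ := exists_potential Γ c
  obtain ⟨a, b, hab⟩ := killing_eq (c.1 ⟨_, hγ⟩).2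
  have h := hasBdry_bdry Γ c hψ hc
  have key := conjCauchy_mob (bdryL2_ae_eq Γ c) (continuousOn_bdry Γ c) (tangential_bdry Γ c) A
    (a := a) (b := b * I) (c := -conj a) (fun w hw =>
      h.comp_mob hψ A (F := fun w => a + b * I * w + -conj a * w ^ 2) (by fun_prop) (fun z => by
        rw [neg_mul, ← sub_eq_add_neg, ← hab z, hc]; rfl) hw) z
  change quadDiff _ ((QuotientGroup.mk A : PSU11) • z) * mobDeriv (QuotientGroup.mk A) z ^ 2 = _
  rw [quadDiff_poissonMap, quadDiff_poissonMap, mobDeriv_mk, coe_smul_eq_mob, mul_assoc, key]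

/-- A Killing field m with δm = c is itself a potential, so the boundary field is the restriction of
a quadratic polynomial, which the contour integral annihilates. -/
lemma quadDiff_eq_zero_of_mem_B1 {c : Z1 Γ} (hc : c ∈ B1 Γ) :
    quadDiff (poissonMap (bdryL2 Γ c)) = 0 := by
  obtain ⟨m, hm⟩ := hc
  obtain ⟨a, b, hab⟩ := killing_eq m.2
  have h := hasBdry_bdry Γ c m.2.1 hm
  have hY : ∀ w, ‖w‖ = 1 → bdry Γ c w = a + b * I * w + -conj a * w ^ 2 := fun w hw =>
    h.eq_of_continuous m.2.1 (F := fun w => a + b * I * w + -conj a * w ^ 2) (by fun_prop)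
      (fun z => by rw [hab]; ring) hw
  funext z
  rw [quadDiff_poissonMap, conjCauchy_of_tangential (bdryL2_ae_eq Γ c)
    fun w hw => conj_eq_of_tangential hw (tangential_bdry Γ c w hw)]
  have e := circleAverage_quadratic a (b * I) (-conj a) z.norm_lt_one
  rw [Real.circleAverage_congr_sphere (f₂ := fun w => (a + b * I * w + -conj a * w ^ 2) *
    conj w ^ 3 * (1 - conj w * z)⁻¹ ^ 4), e, neg_zero, mul_zero, Pi.zero_apply]
  intro w hw
  rw [abs_one, mem_sphere_zero_iff_norm] at hw
  simp only [hY w hw]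

/-- The map `c ↦ (L_{F(ψ♯)} g)^{(2,0)}` on cocycles. -/
def cocycleToHQD : Z1 Γ →ₗ[ℝ] HQD Γ where
  toFun c := ⟨quadDiff (poissonMap (bdryL2 Γ c)), quadDiff_mem_HQD Γ c⟩
  map_add' c d := by
    apply Subtype.ext
    funext z
    change quadDiff _ z = quadDiff _ z + quadDiff _ z
    rw [quadDiff_poissonMap, quadDiff_poissonMap, quadDiff_poissonMap,
      conjCauchy_congr (bdryL2_add_ae_eq Γ c d),
      conjCauchy_add (integrable_CircleL2 _) (integrable_CircleL2 _) 4 z.norm_lt_one, mul_add]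
  map_smul' r c := by
    apply Subtype.ext
    funext z
    change quadDiff _ z = r • quadDiff _ z
    rw [quadDiff_poissonMap, quadDiff_poissonMap, conjCauchy_congr (bdryL2_smul_ae_eq Γ r c),
      conjCauchy_smul, real_smul]
    ring

end

end DiskVF

end

theorem mainTheorem7 (Γ : Subgroup DiskVF.PSU11) [DiscreteTopology Γ]
    [CompactSpace (Quotient (MulAction.orbitRel Γ 𝔻))] :
    (∀ c : DiskVF.Z1 Γ, ∃ ψ : 𝔻 → ℂ, DiskVF.IsSmooth ψ ∧
      ∀ γ : Γ, (c.1 γ : 𝔻 → ℂ) = DiskVF.coboundary Γ ψ γ) ∧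
    (∀ c : DiskVF.Z1 Γ, ∀ ψ : 𝔻 → ℂ, DiskVF.IsSmooth ψ →
      (∀ γ : Γ, (c.1 γ : 𝔻 → ℂ) = DiskVF.coboundary Γ ψ γ) →
      ∃ X : DiskVF.CircleL2, DiskVF.IsL2Boundary ψ X ∧ DiskVF.IsTangential X ∧
        ∀ X' : DiskVF.CircleL2, DiskVF.IsL2Boundary ψ X' → X' = X) ∧
    (∃ Ψ : DiskVF.H1 Γ →ₗ[ℝ] DiskVF.HQD Γ,
      ∀ c : DiskVF.Z1 Γ, ∀ ψ : 𝔻 → ℂ, DiskVF.IsSmooth ψ →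
        (∀ γ : Γ, (c.1 γ : 𝔻 → ℂ) = DiskVF.coboundary Γ ψ γ) →
        ∀ X : DiskVF.CircleL2, DiskVF.IsL2Boundary ψ X →
          DiskVF.IsHarmonic (DiskVF.poissonMap X) ∧
          (Ψ (Submodule.Quotient.mk c) : 𝔻 → ℂ) = DiskVF.quadDiff (DiskVF.poissonMap X)) := by
  refine ⟨DiskVF.exists_potential Γ, fun c ψ hψ hc => ?_, ?_⟩
  · exact ⟨DiskVF.bdryL2 Γ c, DiskVF.isL2Boundary_bdryL2 Γ c hψ hc,
      DiskVF.isTangential_of_ae_eq (DiskVF.bdryL2_ae_eq Γ c) (DiskVF.tangential_bdry Γ c),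
      fun X' hX' => DiskVF.eq_bdryL2 Γ c hψ hc hX'⟩
  · refine ⟨(DiskVF.B1 Γ).liftQ (DiskVF.cocycleToHQD Γ) fun c hc => ?_, fun c ψ hψ hc X hX => ?_⟩
    · exact LinearMap.mem_ker.2 (Subtype.ext (DiskVF.quadDiff_eq_zero_of_mem_B1 Γ hc))
    · refine ⟨DiskVF.isHarmonic_poissonMap X, ?_⟩
      -- Uniqueness of L² boundary values identifies any X with the chosen `bdryL2`, making the
      -- formula independent of ψ and of the representative.
      rw [DiskVF.eq_bdryL2 Γ c hψ hc hX]
      rfl
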